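/- **Theorem (the local Galois groupoid).** Let $q\in\mathbf{C}^*$ with $|q|>1$, let $\mathbf{C}(\{z\})$ be the field of germs at $0$ of meromorphic functions, and let $\sigma_q f(z)=f(qz)$. Let $\mathcal{P}^{(0)}$ be the category whose objects are the pairs $(\mathbf{C}^n,A)$ with $n\in\mathbf{N}$, $A\in GL_n(\mathbf{C})$, and whose morphisms $(\mathbf{C}^n,A)\to(\mathbf{C}^p,B)$ are the matrices $F\in M_{p,n}(\mathbf{C}(\{z\}))$ such that $(\sigma_qF)A=BF$; composition is the product of matrices, the tensor product is $(\mathbf{C}^n,A)\otimes(\mathbf{C}^m,B)=(\mathbf{C}^{nm},A\otimes B)$ with the Kronecker product of matrices, and the unit is $(\mathbf{C},1)$. The entries of such an $F$ extend uniquely to holomorphic functions on $\mathbf{C}^*$; for $z_0\in\mathbf{C}^*$ let $\omega^{(0)}_{z_0}$ be the tensor functor $(\mathbf{C}^n,A)\mapsto\mathbf{C}^n$, $F\mapsto F(z_0)$ from $\mathcal{P}^{(0)}$ to finite dimensional complex vector spaces. Let $\mathcal{R}=Rep_{\mathbf{C}}(\mathbf{Z})$ be the tensor category with the same objects and tensor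 product, but with only the constant morphisms $F\in M_{p,n}(\mathbf{C})$, $FA=BF$, and let $\omega$ be its forgetful functor $(\mathbf{C}^n,A)\mapsto\mathbf{C}^n$, $F\mapsto F$. Every $\omega^{(0)}_{z_0}$ restricts to $\omega$ on $\mathcal{R}$. Write $Aut^{\otimes}$ and $Iso^{\otimes}$ for natural automorphisms and isomorphisms compatible with tensor products and units. Let $\mathbf{Z}^{alg}=Hom_{grp}(\mathbf{C}^*,\mathbf{C}^*)\times\mathbf{C}$. For $A\in GL_n(\mathbf{C})$ write $A=A_sA_u=A_uA_s$ with $A_s=Q\,\mathrm{diag}(c_1,\dots,c_n)\,Q^{-1}$ and $A_u$ unipotent, and for $(\gamma,\lambda)\in\mathbf{Z}^{alg}$ put $$A^{(\gamma,\lambda)}=\gamma(A_s)A_u^{\lambda},\qquad \gamma(A_s)=Q\,\mathrm{diag}(\gamma(c_1),\dots,\gamma(c_n))\,Q^{-1},\qquad A_u^\lambda=\sum_{k\ge 0}\binom{\lambda}{k}(A_u-I_n)^k .$$ Then $A^{(\gamma,\lambda)}$ does not depend on the choices, and letting $(\gamma,\lambda)$ act on $\omega(\mathbf{C}^n,A)=\mathbf{C}^n$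 by $A^{(\gamma,\lambda)}$ defines an isomorphism of groups $\mathbf{Z}^{alg}\to Aut^{\otimes}(\omega)$. For all $z_0,z_1\in\mathbf{C}^*$, restriction to $\mathcal{R}$ is an injection $Iso^{\otimes}(\omega^{(0)}_{z_0},\omega^{(0)}_{z_1})\to Aut^{\otimes}(\omega)$, and, with the identification of $Aut^{\otimes}(\omega)$ with $\mathbf{Z}^{alg}$ above, its image is $$Iso^{\otimes}(\omega^{(0)}_{z_0},\omega^{(0)}_{z_1})=\{(\gamma,\lambda)\in\mathbf{Z}^{alg}\;/\;\gamma(q)z_0=z_1\}.$$ -/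

import Mathlib

namespace LocalGalois

open CategoryTheory MonoidalCategory
open scoped Kronecker

section MatrixCategory

variable {K : Type} [CommRing K]

/-- Kronecker product of matrices, the product of two index sets `Fin n × Fin n'` being
identified with `Fin (n * n')` by the lexicographic order. -/
def kron {p n p' n' : ℕ} (F : Matrix (Fin p) (Fin n) K) (G : Matrix (Fin p') (Fin n') K) :
    Matrix (Fin (p * p')) (Fin (n * n')) K :=
  (F ⊗ₖ G).submatrix finProdFinEquiv.symm finProdFinEquiv.symm

lemma kron_mul {p n m p' n' m' : ℕ} (F : Matrix (Fin p) (Fin n) K) (G : Matrix (Fin p') (Fin n') K)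
    (F₁ : Matrix (Fin n) (Fin m) K) (G₁ : Matrix (Fin n') (Fin m') K) :
    kron F G * kron F₁ G₁ = kron (F * F₁) (G * G₁) := by
  simp only [kron, Matrix.submatrix_mul_equiv, Matrix.mul_kronecker_mul]

lemma kron_one (n m : ℕ) : kron (1 : Matrix (Fin n) (Fin n) K) (1 : Matrix (Fin m) (Fin m) K) = 1 := by
  simp only [kron, Matrix.one_kronecker_one, Matrix.submatrix_one_equiv]

lemma kron_map {L : Type} [CommRing L] {p n p' n' : ℕ} (F : Matrix (Fin p) (Fin n) K)
    (G : Matrix (Fin p') (Fin n') K) (f : K →+* L) :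
    (kron F G).map f = kron (F.map f) (G.map f) := by
  ext i j
  simp [kron]

/-- The matrix of the linear map that permutes (renames) the standard basis by `e`. -/
def permMat (K : Type) [CommRing K] {n m : ℕ} (e : Fin n ≃ Fin m) : Matrix (Fin m) (Fin n) K :=
  (1 : Matrix (Fin m) (Fin m) K).submatrix id e

lemma permMat_mul {n m p : ℕ} (e : Fin n ≃ Fin m) (M : Matrix (Fin n) (Fin p) K) :
    permMat K e * M = M.submatrix e.symm id := by
  ext i j
  simp [permMat, Matrix.mul_apply, Matrix.one_apply, ← Equiv.symm_apply_eq]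

lemma mul_permMat {n m p : ℕ} (e : Fin n ≃ Fin m) (M : Matrix (Fin p) (Fin m) K) :
    M * permMat K e = M.submatrix id e := by
  ext i j
  simp [permMat, Matrix.mul_apply, Matrix.one_apply]

lemma permMat_mul_permMat {n m p : ℕ} (e : Fin n ≃ Fin m) (e' : Fin m ≃ Fin p) :
    permMat K e' * permMat K e = permMat K (e.trans e') := by
  rw [mul_permMat]; rfl

lemma permMat_refl (n : ℕ) : permMat K (Equiv.refl (Fin n)) = 1 := rfl

lemma permMat_map {L : Type} [CommRing L] {n m : ℕ} (e : Fin n ≃ Fin m) (f : K →+* L) :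
    (permMat K e).map f = permMat L e := by
  ext i j
  simp [permMat, Matrix.one_apply, apply_ite f]

/-- The identification of the index sets of `(K^a ⊗ K^b) ⊗ K^c` and of `K^a ⊗ (K^b ⊗ K^c)`. -/
def assocEquiv (a b c : ℕ) : Fin (a * b * c) ≃ Fin (a * (b * c)) :=
  finProdFinEquiv.symm.trans <| (finProdFinEquiv.symm.prodCongr (Equiv.refl _)).trans <|
    (Equiv.prodAssoc _ _ _).trans <| ((Equiv.refl _).prodCongr finProdFinEquiv).trans finProdFinEquiv

/-- The identification of the index sets of `K ⊗ K^a` and of `K^a`. -/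
def leftEquiv (a : ℕ) : Fin (1 * a) ≃ Fin a :=
  finProdFinEquiv.symm.trans (Equiv.uniqueProd (Fin a) (Fin 1))

/-- The identification of the index sets of `K^a ⊗ K` and of `K^a`. -/
def rightEquiv (a : ℕ) : Fin (a * 1) ≃ Fin a :=
  finProdFinEquiv.symm.trans (Equiv.prodUnique (Fin a) (Fin 1))

lemma kron_permMat_one {n m : ℕ} (e : Fin n ≃ Fin m) (c : ℕ) :
    kron (permMat K e) (1 : Matrix (Fin c) (Fin c) K) =
      permMat K (finProdFinEquiv.symm.trans ((e.prodCongr (Equiv.refl _)).trans finProdFinEquiv)) := by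
  ext i j
  obtain ⟨⟨i, i'⟩, rfl⟩ := finProdFinEquiv.surjective i
  obtain ⟨⟨j, j'⟩, rfl⟩ := finProdFinEquiv.surjective j
  simp only [kron, permMat, Matrix.submatrix_apply, Equiv.symm_apply_apply,
    Matrix.kroneckerMap_apply, Matrix.one_apply, Equiv.trans_apply, Equiv.prodCongr_apply,
    Prod.map_apply, id, EmbeddingLike.apply_eq_iff_eq, Prod.mk.injEq, Equiv.refl_apply]
  split_ifs <;> simp_all

lemma kron_one_permMat {n m : ℕ} (e : Fin n ≃ Fin m) (c : ℕ) :
    kron (1 : Matrix (Fin c) (Fin c) K) (permMat K e) =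
      permMat K (finProdFinEquiv.symm.trans (((Equiv.refl _).prodCongr e).trans finProdFinEquiv)) := by
  ext i j
  obtain ⟨⟨i, i'⟩, rfl⟩ := finProdFinEquiv.surjective i
  obtain ⟨⟨j, j'⟩, rfl⟩ := finProdFinEquiv.surjective j
  simp only [kron, permMat, Matrix.submatrix_apply, Equiv.symm_apply_apply,
    Matrix.kroneckerMap_apply, Matrix.one_apply, Equiv.trans_apply, Equiv.prodCongr_apply,
    Prod.map_apply, id, EmbeddingLike.apply_eq_iff_eq, Prod.mk.injEq, Equiv.refl_apply]
  split_ifs <;> simp_all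

lemma assoc_natural {p n p' n' p'' n'' : ℕ} (F : Matrix (Fin p) (Fin n) K)
    (G : Matrix (Fin p') (Fin n') K) (H : Matrix (Fin p'') (Fin n'') K) :
    permMat K (assocEquiv p p' p'') * kron (kron F G) H =
      kron F (kron G H) * permMat K (assocEquiv n n' n'') := by
  rw [permMat_mul, mul_permMat]
  ext i j
  simp [kron, assocEquiv, mul_assoc]

lemma left_natural {p n : ℕ} (F : Matrix (Fin p) (Fin n) K) :
    permMat K (leftEquiv p) * kron (1 : Matrix (Fin 1) (Fin 1) K) F =
      F * permMat K (leftEquiv n) := by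
  rw [permMat_mul, mul_permMat]
  ext i j
  simp [kron, leftEquiv, Subsingleton.elim 0 j.divNat]

lemma right_natural {p n : ℕ} (F : Matrix (Fin p) (Fin n) K) :
    permMat K (rightEquiv p) * kron F (1 : Matrix (Fin 1) (Fin 1) K) =
      F * permMat K (rightEquiv n) := by
  rw [permMat_mul, mul_permMat]
  ext i j
  simp [kron, rightEquiv, Subsingleton.elim 0 j.modNat]

/-- The category of the vector spaces (free modules) `K^n`, `n ∈ ℕ`. -/
structure MatCat (K : Type) where
  /-- the dimension `n` -/
  dim : ℕ

/-- A morphism `K^n → K^p` is a `p × n` matrix, and composition is the product of matrices. -/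
instance : Category (MatCat K) where
  Hom V W := Matrix (Fin W.dim) (Fin V.dim) K
  id V := (1 : Matrix (Fin V.dim) (Fin V.dim) K)
  comp {U V W} (F : Matrix (Fin V.dim) (Fin U.dim) K) (G : Matrix (Fin W.dim) (Fin V.dim) K) := G * F
  id_comp _ := Matrix.mul_one _
  comp_id _ := Matrix.one_mul _
  assoc _ _ _ := (Matrix.mul_assoc _ _ _).symm

lemma matCat_id (V : MatCat K) : 𝟙 V = (1 : Matrix (Fin V.dim) (Fin V.dim) K) := rfl

lemma matCat_comp {U V W : MatCat K} (F : U ⟶ V) (G : V ⟶ W) :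
    F ≫ G = (show Matrix (Fin W.dim) (Fin V.dim) K from G) *
      (show Matrix (Fin V.dim) (Fin U.dim) K from F) := rfl

/-- The isomorphism given by a permutation matrix. -/
def permIso {V W : MatCat K} (e : Fin V.dim ≃ Fin W.dim) : V ≅ W where
  hom := permMat K e
  inv := permMat K e.symm
  hom_inv_id := by rw [matCat_comp, permMat_mul_permMat, Equiv.self_trans_symm]; rfl
  inv_hom_id := by rw [matCat_comp, permMat_mul_permMat, Equiv.symm_trans_self]; rfl

/-- The tensor product: `K^n ⊗ K^m = K^(nm)`, with the Kronecker product of matrices. -/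
instance : MonoidalCategoryStruct (MatCat K) where
  tensorObj V W := ⟨V.dim * W.dim⟩
  tensorUnit := ⟨1⟩
  tensorHom F G := kron F G
  whiskerLeft V _ _ G := kron (1 : Matrix (Fin V.dim) (Fin V.dim) K) G
  whiskerRight F W := kron F (1 : Matrix (Fin W.dim) (Fin W.dim) K)
  associator U V W := permIso (assocEquiv U.dim V.dim W.dim)
  leftUnitor V := permIso (leftEquiv V.dim)
  rightUnitor V := permIso (rightEquiv V.dim)

lemma pentagon_aux (a b c d : ℕ) :
    kron (1 : Matrix (Fin a) (Fin a) K) (permMat K (assocEquiv b c d)) *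
      permMat K (assocEquiv a (b * c) d) * kron (permMat K (assocEquiv a b c)) (1 : Matrix (Fin d) (Fin d) K) =
    permMat K (assocEquiv a b (c * d)) * permMat K (assocEquiv (a * b) c d) := by
  rw [kron_one_permMat, kron_permMat_one, permMat_mul_permMat, permMat_mul_permMat,
    permMat_mul_permMat]
  congr 1
  ext i : 1
  simp [assocEquiv]

lemma triangle_aux (a b : ℕ) :
    kron (1 : Matrix (Fin a) (Fin a) K) (permMat K (leftEquiv b)) * permMat K (assocEquiv a 1 b) =
    kron (permMat K (rightEquiv a)) (1 : Matrix (Fin b) (Fin b) K) := by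
  rw [kron_one_permMat, kron_permMat_one, permMat_mul_permMat]
  congr 1
  ext i : 1
  simp [assocEquiv, leftEquiv, rightEquiv]

lemma strict_assoc_aux (a b c : ℕ) :
    permMat K (assocEquiv a b c) * (1 : Matrix (Fin (a * b * c)) (Fin (a * b * c)) K) *
      kron (1 : Matrix (Fin (a * b)) (Fin (a * b)) K) (1 : Matrix (Fin c) (Fin c) K) =
    (1 : Matrix (Fin (a * (b * c))) (Fin (a * (b * c))) K) *
      kron (1 : Matrix (Fin a) (Fin a) K) (1 : Matrix (Fin (b * c)) (Fin (b * c)) K) *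
      permMat K (assocEquiv a b c) := by
  simp only [kron_one, Matrix.mul_one, Matrix.one_mul]

lemma strict_left_aux (a : ℕ) :
    permMat K (leftEquiv a) = permMat K (leftEquiv a) *
      (1 : Matrix (Fin (1 * a)) (Fin (1 * a)) K) *
      kron (1 : Matrix (Fin 1) (Fin 1) K) (1 : Matrix (Fin a) (Fin a) K) := by
  simp only [kron_one, Matrix.mul_one]

lemma strict_right_aux (a : ℕ) :
    permMat K (rightEquiv a) = permMat K (rightEquiv a) *
      (1 : Matrix (Fin (a * 1)) (Fin (a * 1)) K) *
      kron (1 : Matrix (Fin a) (Fin a) K) (1 : Matrix (Fin 1) (Fin 1) K) := by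
  simp only [kron_one, Matrix.mul_one]

instance : MonoidalCategory (MatCat K) :=
  MonoidalCategory.ofTensorHom
    (id_tensorHom_id := fun V W => kron_one V.dim W.dim)
    (id_tensorHom := fun _ _ _ _ => rfl)
    (tensorHom_id := fun _ _ => rfl)
    (tensorHom_comp_tensorHom := fun _ _ _ _ => kron_mul _ _ _ _)
    (associator_naturality := fun _ _ _ => assoc_natural _ _ _)
    (leftUnitor_naturality := fun F => left_natural F)
    (rightUnitor_naturality := fun F => right_natural F)
    (pentagon := fun _ _ _ _ => pentagon_aux _ _ _ _)
    (triangle := fun _ _ => triangle_aux _ _)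

end MatrixCategory

section FlatSystems

variable {K : Type} [CommRing K] [Algebra ℂ K] {σ : K →ₐ[ℂ] K}

/-- A complex matrix seen as a (constant) matrix over the function ring `K`. -/
def constMat (K : Type) [CommRing K] [Algebra ℂ K] {p n : ℕ} (A : Matrix (Fin p) (Fin n) ℂ) :
    Matrix (Fin p) (Fin n) K :=
  A.map (algebraMap ℂ K)

/-- Flat (constant coefficient) difference systems `(ℂ^n, A)`, `A ∈ GL_n(ℂ)`, i.e. the systems
`σ X = A X`, over the difference ring `(K, σ)`. -/
structure FlatSys (K : Type) [CommRing K] [Algebra ℂ K] (σ : K →ₐ[ℂ] K) where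
  /-- the rank `n` -/
  rank : ℕ
  /-- the invertible matrix `A` -/
  A : GL (Fin rank) ℂ

/-- A morphism `(ℂ^n, A) → (ℂ^p, B)` is a matrix `F ∈ M_{p,n}(K)` with `(σ F) A = B F`. -/
@[ext]
structure FlatSys.Hom (X Y : FlatSys K σ) where
  /-- the matrix `F` -/
  mat : Matrix (Fin Y.rank) (Fin X.rank) K
  comm : mat.map σ * constMat K X.A.val = constMat K Y.A.val * mat

lemma constMat_mul {p n m : ℕ} (A : Matrix (Fin p) (Fin n) ℂ) (B : Matrix (Fin n) (Fin m) ℂ) :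
    constMat K (A * B) = constMat K A * constMat K B := Matrix.map_mul

lemma constMat_one (n : ℕ) : constMat K (1 : Matrix (Fin n) (Fin n) ℂ) = 1 :=
  Matrix.map_one _ (map_zero _) (map_one _)

lemma constMat_kron {p n p' n' : ℕ} (A : Matrix (Fin p) (Fin n) ℂ) (B : Matrix (Fin p') (Fin n') ℂ) :
    constMat K (kron A B) = kron (constMat K A) (constMat K B) := kron_map _ _ _

lemma constMat_map {p n : ℕ} (A : Matrix (Fin p) (Fin n) ℂ) (σ : K →ₐ[ℂ] K) :
    (constMat K A).map σ = constMat K A := by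
  ext i j
  simp [constMat]

lemma one_map_alg (n : ℕ) (σ : K →ₐ[ℂ] K) : (1 : Matrix (Fin n) (Fin n) K).map σ = 1 :=
  Matrix.map_one _ (map_zero _) (map_one _)

/-- The category of flat systems; composition is the product of matrices. -/
instance : Category (FlatSys K σ) where
  Hom X Y := FlatSys.Hom X Y
  id X := ⟨1, by rw [one_map_alg, Matrix.one_mul, Matrix.mul_one]⟩
  comp {X Y Z} F G := ⟨G.mat * F.mat, by
    rw [Matrix.map_mul, Matrix.mul_assoc, F.comm, ← Matrix.mul_assoc, G.comm, Matrix.mul_assoc]⟩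
  id_comp _ := FlatSys.Hom.ext (Matrix.mul_one _)
  comp_id _ := FlatSys.Hom.ext (Matrix.one_mul _)
  assoc _ _ _ := FlatSys.Hom.ext (Matrix.mul_assoc _ _ _).symm

/-- The matrix of a morphism of flat systems. -/
abbrev FlatSys.matrix {X Y : FlatSys K σ} (F : X ⟶ Y) : Matrix (Fin Y.rank) (Fin X.rank) K :=
  FlatSys.Hom.mat F

lemma flatSys_ext {X Y : FlatSys K σ} {F G : X ⟶ Y}
    (h : FlatSys.matrix F = FlatSys.matrix G) : F = G := FlatSys.Hom.ext h

/-- The tensor product of invertible matrices is invertible. -/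
def kronGL {n m : ℕ} (A : GL (Fin n) ℂ) (B : GL (Fin m) ℂ) : GL (Fin (n * m)) ℂ where
  val := kron A.val B.val
  inv := kron A.inv B.inv
  val_inv := by rw [kron_mul, A.val_inv, B.val_inv, kron_one]
  inv_val := by rw [kron_mul, A.inv_val, B.inv_val, kron_one]

/-- Forgetting the matrix `A`: the functor `(ℂ^n, A) ↦ K^n`, `F ↦ F`. -/
def toMat (K : Type) [CommRing K] [Algebra ℂ K] (σ : K →ₐ[ℂ] K) : FlatSys K σ ⥤ MatCat K where
  obj X := ⟨X.rank⟩
  map F := FlatSys.matrix F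
  map_id _ := rfl
  map_comp _ _ := rfl

/-- The tensor product of two morphisms. -/
def FlatSys.Hom.tensor {X Y X' Y' : FlatSys K σ} (F : FlatSys.Hom X Y) (G : FlatSys.Hom X' Y') :
    FlatSys.Hom (σ := σ) ⟨X.rank * X'.rank, kronGL X.A X'.A⟩ ⟨Y.rank * Y'.rank, kronGL Y.A Y'.A⟩ where
  mat := kron F.mat G.mat
  comm := by
    have h : (kron F.mat G.mat).map σ = kron (F.mat.map σ) (G.mat.map σ) :=
      kron_map _ _ (σ : K →+* K)
    rw [h]
    simp only [kronGL, constMat_kron, kron_mul, F.comm, G.comm]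

/-- A permutation of bases that is compatible with the matrices is an isomorphism. -/
def FlatSys.permIso {X Y : FlatSys K σ} (e : Fin X.rank ≃ Fin Y.rank)
    (h : permMat ℂ e * X.A.val = Y.A.val * permMat ℂ e) : X ≅ Y where
  hom := FlatSys.Hom.mk (permMat K e) (by
    have h1 : (permMat K e).map σ = permMat K e := permMat_map e (σ : K →+* K)
    have h2 : constMat K (permMat ℂ e) = permMat K e := permMat_map e (algebraMap ℂ K)
    rw [h1, ← h2, ← constMat_mul, ← constMat_mul, h])
  inv := FlatSys.Hom.mk (permMat K e.symm) (by
    have h1 : (permMat K e.symm).map σ = permMat K e.symm := permMat_map e.symm (σ : K →+* K)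
    have h2 : constMat K (permMat ℂ e.symm) = permMat K e.symm :=
      permMat_map e.symm (algebraMap ℂ K)
    have h3 : permMat ℂ e.symm * Y.A.val = X.A.val * permMat ℂ e.symm := by
      have h4 : permMat ℂ e.symm * (permMat ℂ e * X.A.val) * permMat ℂ e.symm =
          permMat ℂ e.symm * (Y.A.val * permMat ℂ e) * permMat ℂ e.symm := by rw [h]
      rw [← Matrix.mul_assoc, permMat_mul_permMat, Equiv.self_trans_symm, permMat_refl,
        Matrix.one_mul, Matrix.mul_assoc, Matrix.mul_assoc, permMat_mul_permMat,
        Equiv.symm_trans_self, permMat_refl, Matrix.mul_one] at h4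
      exact h4.symm
    rw [h1, ← h2, ← constMat_mul, ← constMat_mul, h3])
  hom_inv_id := flatSys_ext (by
    change permMat K e.symm * permMat K e = 1
    rw [permMat_mul_permMat, Equiv.self_trans_symm, permMat_refl])
  inv_hom_id := flatSys_ext (by
    change permMat K e * permMat K e.symm = 1
    rw [permMat_mul_permMat, Equiv.symm_trans_self, permMat_refl])

/-- `(ℂ^n, A) ⊗ (ℂ^m, B) = (ℂ^(nm), A ⊗ B)`, the tensor product of morphisms is that of
their matrices, and the unit is `(ℂ, 1)`. -/
instance : MonoidalCategoryStruct (FlatSys K σ) where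
  tensorObj X Y := ⟨X.rank * Y.rank, kronGL X.A Y.A⟩
  tensorUnit := ⟨1, 1⟩
  tensorHom F G := FlatSys.Hom.tensor F G
  whiskerLeft X _ _ G := FlatSys.Hom.tensor (𝟙 X) G
  whiskerRight F Y := FlatSys.Hom.tensor F (𝟙 Y)
  associator X Y Z := FlatSys.permIso (assocEquiv X.rank Y.rank Z.rank)
    (assoc_natural X.A.val Y.A.val Z.A.val)
  leftUnitor X := FlatSys.permIso (leftEquiv X.rank) (left_natural X.A.val)
  rightUnitor X := FlatSys.permIso (rightEquiv X.rank) (right_natural X.A.val)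

instance : MonoidalCategory (FlatSys K σ) :=
  MonoidalCategory.ofTensorHom
    (id_tensorHom_id := fun X Y => flatSys_ext (kron_one X.rank Y.rank))
    (id_tensorHom := fun _ _ _ _ => rfl)
    (tensorHom_id := fun _ _ => rfl)
    (tensorHom_comp_tensorHom := fun _ _ _ _ => flatSys_ext (kron_mul _ _ _ _))
    (associator_naturality := fun _ _ _ => flatSys_ext (assoc_natural _ _ _))
    (leftUnitor_naturality := fun F => flatSys_ext (left_natural F.mat))
    (rightUnitor_naturality := fun F => flatSys_ext (right_natural F.mat))
    (pentagon := fun _ _ _ _ => flatSys_ext (pentagon_aux _ _ _ _))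
    (triangle := fun _ _ => flatSys_ext (triangle_aux _ _))

/-- `toMat` is a tensor functor, with identities as structural isomorphisms. -/
instance : (toMat K σ).Monoidal := Functor.CoreMonoidal.toMonoidal
  { εIso := Iso.refl _
    μIso := fun _ _ => Iso.refl _
    μIso_hom_natural_left := fun _ _ => (Category.comp_id _).trans (Category.id_comp _).symm
    μIso_hom_natural_right := fun _ _ => (Category.comp_id _).trans (Category.id_comp _).symm
    associativity := fun X Y Z => strict_assoc_aux X.rank Y.rank Z.rank
    left_unitality := fun X => strict_left_aux X.rank
    right_unitality := fun X => strict_right_aux X.rank }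

end FlatSystems

section Germs
open Filter Topology

/-- The ring `ℂ({z})` of germs at `0` of meromorphic functions (germs of functions on punctured
neighbourhoods of `0`). -/
def MeroGerm : Subring (Germ (𝓝[≠] (0 : ℂ)) ℂ) where
  carrier := {g | ∃ f : ℂ → ℂ, MeromorphicAt f 0 ∧ (f : Germ (𝓝[≠] (0 : ℂ)) ℂ) = g}
  mul_mem' := by
    rintro _ _ ⟨f, hf, rfl⟩ ⟨g, hg, rfl⟩
    exact ⟨f * g, hf.mul hg, rfl⟩
  one_mem' := ⟨fun _ => 1, MeromorphicAt.const 1 0, rfl⟩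
  add_mem' := by
    rintro _ _ ⟨f, hf, rfl⟩ ⟨g, hg, rfl⟩
    exact ⟨f + g, hf.add hg, rfl⟩
  zero_mem' := ⟨fun _ => 0, MeromorphicAt.const 0 0, rfl⟩
  neg_mem' := by
    rintro _ ⟨f, hf, rfl⟩
    exact ⟨-f, hf.neg, rfl⟩

/-- The constants as germs. -/
noncomputable def constGerm : ℂ →+* MeroGerm where
  toFun c := ⟨((fun _ : ℂ => c : ℂ → ℂ) : Germ (𝓝[≠] (0 : ℂ)) ℂ), _, MeromorphicAt.const c 0, rfl⟩
  map_one' := rfl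
  map_zero' := rfl
  map_mul' _ _ := rfl
  map_add' _ _ := rfl

noncomputable instance : Algebra ℂ MeroGerm := constGerm.toAlgebra

lemma tendsto_mul_punctured (q : ℂˣ) :
    Tendsto (fun z : ℂ => (q : ℂ) * z) (𝓝[≠] 0) (𝓝[≠] 0) := by
  refine tendsto_nhdsWithin_iff.2 ⟨?_, ?_⟩
  · have : Tendsto (fun z : ℂ => (q : ℂ) * z) (𝓝 0) (𝓝 ((q : ℂ) * 0)) :=
      (continuous_const.mul continuous_id).tendsto 0
    rw [mul_zero] at this
    exact this.mono_left nhdsWithin_le_nhds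
  · filter_upwards [self_mem_nhdsWithin] with z hz
    exact mul_ne_zero q.ne_zero hz

lemma meroGerm_comp_mem (q : ℂˣ) {g : Germ (𝓝[≠] (0 : ℂ)) ℂ} (hg : g ∈ MeroGerm) :
    g.compTendsto _ (tendsto_mul_punctured q) ∈ MeroGerm := by
  obtain ⟨f, hf, rfl⟩ := hg
  refine ⟨fun z => f (q * z), ?_, rfl⟩
  have h : AnalyticAt ℂ (fun z : ℂ => (q : ℂ) * z) 0 := by fun_prop
  exact MeromorphicAt.comp_analyticAt (by simpa using hf) h

/-- The `q`-difference operator `σ_q : f(z) ↦ f(qz)` on germs. -/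
noncomputable def sigmaQ (q : ℂˣ) : MeroGerm →ₐ[ℂ] MeroGerm where
  toFun g := ⟨(g : Germ (𝓝[≠] (0 : ℂ)) ℂ).compTendsto _ (tendsto_mul_punctured q),
    meroGerm_comp_mem q g.2⟩
  map_one' := rfl
  map_zero' := rfl
  map_mul' := by
    rintro ⟨_, f, hf, rfl⟩ ⟨_, g, hg, rfl⟩
    rfl
  map_add' := by
    rintro ⟨_, f, hf, rfl⟩ ⟨_, g, hg, rfl⟩
    rfl
  commutes' _ := rfl

/-- `f` is a continuation of the germ `g` to a holomorphic function on `ℂ^*`. -/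
def Continues (g : MeroGerm) (f : ℂ → ℂ) : Prop :=
  AnalyticOnNhd ℂ f {0}ᶜ ∧ (f : Germ (𝓝[≠] (0 : ℂ)) ℂ) = g

lemma Continues.unique {g : MeroGerm} {f f' : ℂ → ℂ} (h : Continues g f) (h' : Continues g f')
    {z : ℂ} (hz : z ≠ 0) : f z = f' z := by
  have hp : IsPreconnected ({0}ᶜ : Set ℂ) :=
    (isConnected_compl_singleton_of_one_lt_rank (by simp) (0 : ℂ)).isPreconnected
  have he : f =ᶠ[𝓝[≠] 0] f' := Germ.coe_eq.1 (h.2.trans h'.2.symm)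
  have he2 : ∀ᶠ w in 𝓝[≠] (0 : ℂ), f =ᶠ[𝓝 w] f' := by
    have := eventually_eventually_nhdsWithin.2 he
    filter_upwards [this, self_mem_nhdsWithin] with w hw hw0
    rwa [IsOpen.nhdsWithin_eq isOpen_compl_singleton hw0] at hw
  obtain ⟨w, hw, hw0⟩ := (he2.and self_mem_nhdsWithin).exists
  exact h.1.eqOn_of_preconnected_of_eventuallyEq h'.1 hp hw0 hw hz

open Classical in
/-- The value at `z` of (the holomorphic continuation to `ℂ^*` of) a germ; by convention `0`
if there is no continuation. -/
noncomputable def germEval (g : MeroGerm) (z : ℂ) : ℂ :=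
  if h : ∃ f, Continues g f then h.choose z else 0

lemma Continues.eval {g : MeroGerm} {f : ℂ → ℂ} (h : Continues g f) {z : ℂ} (hz : z ≠ 0) :
    germEval g z = f z := by
  have h' : ∃ f, Continues g f := ⟨f, h⟩
  rw [germEval, dif_pos h']
  exact h'.choose_spec.unique h hz

lemma Continues.const (c : ℂ) : Continues (algebraMap ℂ MeroGerm c) (fun _ => c) :=
  ⟨fun _ _ => analyticAt_const, rfl⟩

lemma Continues.mul {g g' : MeroGerm} {f f' : ℂ → ℂ} (h : Continues g f) (h' : Continues g' f') :
    Continues (g * g') (f * f') :=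
  ⟨h.1.mul h'.1, by rw [Germ.coe_mul, h.2, h'.2]; rfl⟩

lemma Continues.add {g g' : MeroGerm} {f f' : ℂ → ℂ} (h : Continues g f) (h' : Continues g' f') :
    Continues (g + g') (f + f') :=
  ⟨h.1.add h'.1, by rw [Germ.coe_add, h.2, h'.2]; rfl⟩

lemma Continues.sum {ι : Type} (s : Finset ι) {g : ι → MeroGerm} {f : ι → ℂ → ℂ}
    (h : ∀ i, Continues (g i) (f i)) : Continues (∑ i ∈ s, g i) (∑ i ∈ s, f i) := by
  classical
  induction s using Finset.induction_on with
  | empty => exact ⟨fun _ _ => analyticAt_const, rfl⟩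
  | insert a s ha ih => rw [Finset.sum_insert ha, Finset.sum_insert ha]; exact (h a).add ih

/-- The category of flat objects of the local category at `0`: objects `(ℂ^n, A)`, morphisms
`(ℂ^n, A) → (ℂ^p, B)` the `F ∈ M_{p,n}(ℂ({z}))` such that `F(qz) A = B F(z)`. -/
abbrev FlatLocal (q : ℂˣ) : Type := FlatSys MeroGerm (sigmaQ q)

/-- Every entry of a morphism in `FlatLocal q` has a continuation to `ℂ^*`. -/
lemma exists_continues {q : ℂˣ} (hq : 1 < ‖(q : ℂ)‖) {X Y : FlatLocal q} (F : X ⟶ Y) :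
    ∃ f : Fin Y.rank → Fin X.rank → ℂ → ℂ, ∀ i j, Continues (FlatSys.matrix F i j) (f i j) := by
  classical
  choose f hf hfg using fun i j => (FlatSys.matrix F i j).2
  set A : Matrix (Fin X.rank) (Fin X.rank) ℂ := X.A.val with hA
  set B : Matrix (Fin Y.rank) (Fin Y.rank) ℂ := Y.A.val with hB
  set A' : Matrix (Fin X.rank) (Fin X.rank) ℂ := X.A.inv with hA'
  let M : ℂ → Matrix (Fin Y.rank) (Fin X.rank) ℂ := fun z => Matrix.of fun i j => f i j z
  -- functional equation near 0
  have h1 : ∀ᶠ z in 𝓝[≠] (0 : ℂ), M (q * z) * A = B * M z := by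
    have : ∀ i j, ∀ᶠ z in 𝓝[≠] (0 : ℂ), (M (q * z) * A) i j = (B * M z) i j := by
      intro i j
      have hc := congrArg Subtype.val (congrFun (congrFun F.comm i) j)
      simp only [Matrix.mul_apply, AddSubmonoidClass.coe_finsetSum, Subring.coe_mul] at hc
      have hl : ((fun z => (M (q * z) * A) i j : ℂ → ℂ) : Germ (𝓝[≠] (0 : ℂ)) ℂ) =
          ∑ k, ((F.mat.map (sigmaQ q) i k : MeroGerm) : Germ (𝓝[≠] (0 : ℂ)) ℂ) *
            ((constMat MeroGerm X.A.val k j : MeroGerm) : Germ (𝓝[≠] (0 : ℂ)) ℂ) := by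
        have : (fun z => (M (q * z) * A) i j : ℂ → ℂ) =
            ∑ k, (fun z => f i k (q * z)) * (fun _ => A k j) := by
          funext z
          simp [M, Matrix.mul_apply, Finset.sum_apply]
        rw [this]
        change Germ.coeRingHom _ _ = _
        rw [map_sum]
        refine Finset.sum_congr rfl fun k _ => ?_
        rw [map_mul]
        have h0 : F.mat i k = ⟨(f i k : Germ (𝓝[≠] (0 : ℂ)) ℂ), f i k, hf i k, rfl⟩ :=
          Subtype.ext (hfg i k).symm
        rw [Matrix.map_apply, h0]
        rfl
      have hr : ((fun z => (B * M z) i j : ℂ → ℂ) : Germ (𝓝[≠] (0 : ℂ)) ℂ) =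
          ∑ k, ((constMat MeroGerm Y.A.val i k : MeroGerm) : Germ (𝓝[≠] (0 : ℂ)) ℂ) *
            ((F.mat k j : MeroGerm) : Germ (𝓝[≠] (0 : ℂ)) ℂ) := by
        have : (fun z => (B * M z) i j : ℂ → ℂ) = ∑ k, (fun _ => B i k) * f k j := by
          funext z
          simp [M, Matrix.mul_apply, Finset.sum_apply]
        rw [this]
        change Germ.coeRingHom _ _ = _
        rw [map_sum]
        refine Finset.sum_congr rfl fun k _ => ?_
        rw [map_mul, ← hfg k j]
        rfl
      exact Germ.coe_eq.1 (hl.trans (hc.trans hr.symm))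
    filter_upwards [eventually_all.2 fun i => eventually_all.2 fun j => this i j] with z hz
    ext i j
    exact hz i j
  have h2 : ∀ᶠ z in 𝓝[≠] (0 : ℂ), ∀ i j, AnalyticAt ℂ (f i j) z :=
    eventually_all.2 fun i => eventually_all.2 fun j => (hf i j).eventually_analyticAt
  obtain ⟨r, hr, hr'⟩ : ∃ r > 0, ∀ z : ℂ, z ≠ 0 → ‖z‖ < r →
      M (q * z) * A = B * M z ∧ ∀ i j, AnalyticAt ℂ (f i j) z := by
    have := (h1.and h2)
    rw [eventually_nhdsWithin_iff, Metric.eventually_nhds_iff] at this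
    obtain ⟨r, hr, h⟩ := this
    exact ⟨r, hr, fun z hz hzr => h (by simpa using hzr) hz⟩
  have hAA' : A * A' = 1 := X.A.val_inv
  -- the k-th extension
  let H : ℕ → ℂ → Matrix (Fin Y.rank) (Fin X.rank) ℂ :=
    fun k z => B ^ k * M ((q : ℂ)⁻¹ ^ k * z) * A' ^ k
  have hstep : ∀ k z, z ≠ 0 → ‖(q : ℂ)⁻¹ ^ k * z‖ < r → H (k + 1) z = H k z ∧
      ‖(q : ℂ)⁻¹ ^ (k + 1) * z‖ < r := by
    intro k z hz hk
    have hlt : ‖(q : ℂ)⁻¹ ^ (k + 1) * z‖ < r := by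
      refine lt_of_le_of_lt ?_ hk
      rw [pow_succ', mul_assoc, norm_mul]
      refine mul_le_of_le_one_left (norm_nonneg _) ?_
      rw [norm_inv]
      exact inv_le_one_of_one_le₀ hq.le
    refine ⟨?_, hlt⟩
    have hne : (q : ℂ)⁻¹ ^ (k + 1) * z ≠ 0 :=
      mul_ne_zero (pow_ne_zero _ (inv_ne_zero q.ne_zero)) hz
    have h3 := (hr' _ hne hlt).1
    have h4 : (q : ℂ) * ((q : ℂ)⁻¹ ^ (k + 1) * z) = (q : ℂ)⁻¹ ^ k * z := by
      rw [pow_succ', ← mul_assoc, ← mul_assoc, mul_inv_cancel₀ q.ne_zero, one_mul]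
    rw [h4] at h3
    change B ^ (k + 1) * M ((q : ℂ)⁻¹ ^ (k + 1) * z) * A' ^ (k + 1) = B ^ k * M _ * A' ^ k
    rw [pow_succ B, pow_succ' A']
    calc B ^ k * B * M ((q : ℂ)⁻¹ ^ (k + 1) * z) * (A' * A' ^ k)
        = B ^ k * (B * M ((q : ℂ)⁻¹ ^ (k + 1) * z)) * (A' * A' ^ k) := by
          simp only [Matrix.mul_assoc]
      _ = B ^ k * M ((q : ℂ)⁻¹ ^ k * z) * (A * A') * A' ^ k := by
          rw [← h3]; simp only [Matrix.mul_assoc]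
      _ = _ := by rw [hAA', Matrix.mul_one]
  have hmono : ∀ z, z ≠ 0 → ∀ k l, k ≤ l → ‖(q : ℂ)⁻¹ ^ k * z‖ < r → H l z = H k z := by
    intro z hz k l hkl hk
    have : H l z = H k z ∧ ‖(q : ℂ)⁻¹ ^ l * z‖ < r := by
      induction l, hkl using Nat.le_induction with
      | base => exact ⟨rfl, hk⟩
      | succ l _ ih => exact ⟨(hstep l z hz ih.2).1.trans ih.1, (hstep l z hz ih.2).2⟩
    exact this.1
  have hex : ∀ z : ℂ, ∃ k : ℕ, ‖(q : ℂ)⁻¹ ^ k * z‖ < r := by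
    intro z
    have h5 : ‖(q : ℂ)⁻¹‖ < 1 := by rw [norm_inv]; exact inv_lt_one_of_one_lt₀ hq
    have h6 : Tendsto (fun k : ℕ => (q : ℂ)⁻¹ ^ k * z) atTop (𝓝 (0 * z)) :=
      (tendsto_pow_atTop_nhds_zero_of_norm_lt_one h5).mul_const z
    rw [zero_mul] at h6
    have h7 := h6.norm
    rw [norm_zero] at h7
    exact (h7.eventually (gt_mem_nhds hr)).exists
  let k : ℂ → ℕ := fun z => Nat.find (hex z)
  have hk : ∀ z, ‖(q : ℂ)⁻¹ ^ k z * z‖ < r := fun z => Nat.find_spec (hex z)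
  let G : ℂ → Matrix (Fin Y.rank) (Fin X.rank) ℂ := fun z => H (k z) z
  have hG : ∀ z l, z ≠ 0 → ‖(q : ℂ)⁻¹ ^ l * z‖ < r → G z = H l z := fun z l hz hl =>
    (hmono z hz (k z) l (Nat.find_min' (hex z) hl) (hk z)).symm
  refine ⟨fun i j z => G z i j, fun i j => ⟨fun z hz => ?_, ?_⟩⟩
  · have hz' : z ≠ 0 := hz
    have hnear : ∀ᶠ w in 𝓝 z, G w i j = H (k z) w i j := by
      have hc : Continuous fun w : ℂ => ‖(q : ℂ)⁻¹ ^ k z * w‖ := by fun_prop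
      filter_upwards [hc.continuousAt.eventually (gt_mem_nhds (hk z)), isOpen_ne.mem_nhds hz']
        with w hw hw0
      rw [hG w (k z) hw0 hw]
    refine AnalyticAt.congr ?_ (hnear.mono fun _ h => h.symm)
    have hne : (q : ℂ)⁻¹ ^ k z * z ≠ 0 :=
      mul_ne_zero (pow_ne_zero _ (inv_ne_zero q.ne_zero)) hz'
    have han := (hr' _ hne (hk z)).2
    have hfun : (fun w => H (k z) w i j) = fun w => ∑ b, (∑ a, (B ^ k z) i a *
        f a b ((q : ℂ)⁻¹ ^ k z * w)) * (A' ^ k z) b j := by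
      funext w
      simp [H, M, Matrix.mul_apply]
    rw [hfun]
    refine Finset.analyticAt_fun_sum _ fun b _ => AnalyticAt.mul ?_ analyticAt_const
    refine Finset.analyticAt_fun_sum _ fun a _ => AnalyticAt.mul analyticAt_const ?_
    exact AnalyticAt.fun_comp (han a b) (by fun_prop)
  · rw [← hfg i j]
    refine Germ.coe_eq.2 ?_
    rw [EventuallyEq, eventually_nhdsWithin_iff, Metric.eventually_nhds_iff]
    refine ⟨r, hr, fun z hz hz0 => ?_⟩
    have := hG z 0 hz0 (by simpa using hz)
    simp [this, H, M]

lemma germEval_const (c z : ℂ) (hz : z ≠ 0) : germEval (algebraMap ℂ MeroGerm c) z = c :=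
  (Continues.const c).eval hz

lemma germEval_mul {n m p : ℕ} {F : Matrix (Fin n) (Fin m) MeroGerm}
    {G : Matrix (Fin m) (Fin p) MeroGerm} {f : Fin n → Fin m → ℂ → ℂ} {g : Fin m → Fin p → ℂ → ℂ}
    (hF : ∀ i j, Continues (F i j) (f i j)) (hG : ∀ i j, Continues (G i j) (g i j))
    {z : ℂ} (hz : z ≠ 0) :
    (F * G).map (germEval · z) = F.map (germEval · z) * G.map (germEval · z) := by
  ext i j
  have h : Continues ((F * G) i j) (∑ k, f i k * g k j) := by
    rw [Matrix.mul_apply]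
    exact Continues.sum _ fun k => (hF i k).mul (hG k j)
  simp only [Matrix.map_apply, Matrix.mul_apply]
  rw [← Matrix.mul_apply, h.eval hz, Finset.sum_apply]
  refine Finset.sum_congr rfl fun k _ => ?_
  rw [(hF i k).eval hz, (hG k j).eval hz, Pi.mul_apply]

lemma germEval_kron {n m n' m' : ℕ} {F : Matrix (Fin n) (Fin m) MeroGerm}
    {G : Matrix (Fin n') (Fin m') MeroGerm} {f : Fin n → Fin m → ℂ → ℂ}
    {g : Fin n' → Fin m' → ℂ → ℂ}
    (hF : ∀ i j, Continues (F i j) (f i j)) (hG : ∀ i j, Continues (G i j) (g i j))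
    {z : ℂ} (hz : z ≠ 0) :
    (kron F G).map (germEval · z) = kron (F.map (germEval · z)) (G.map (germEval · z)) := by
  ext i j
  simp only [kron, Matrix.map_apply, Matrix.submatrix_apply, Matrix.kroneckerMap_apply]
  rw [((hF _ _).mul (hG _ _)).eval hz, (hF _ _).eval hz, (hG _ _).eval hz, Pi.mul_apply]

lemma germEval_constMat {n m : ℕ} (A : Matrix (Fin n) (Fin m) ℂ) {z : ℂ} (hz : z ≠ 0) :
    (constMat MeroGerm A).map (germEval · z) = A := by
  ext i j
  exact germEval_const _ _ hz

lemma germEval_one (n : ℕ) {z : ℂ} (hz : z ≠ 0) :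
    (1 : Matrix (Fin n) (Fin n) MeroGerm).map (germEval · z) = 1 := by
  rw [← constMat_one, germEval_constMat _ hz]

lemma germEval_permMat {n m : ℕ} (e : Fin n ≃ Fin m) {z : ℂ} (hz : z ≠ 0) :
    (permMat MeroGerm e).map (germEval · z) = permMat ℂ e := by
  have h : constMat MeroGerm (permMat ℂ e) = permMat MeroGerm e :=
    permMat_map e (algebraMap ℂ MeroGerm)
  rw [← h, germEval_constMat _ hz]

/-- The local fibre functor at `z₀`: `(ℂ^n, A) ↦ ℂ^n`, `F ↦ F(z₀)`. -/
noncomputable def fibre (q : ℂˣ) (hq : 1 < ‖(q : ℂ)‖) (z₀ : ℂˣ) : FlatLocal q ⥤ MatCat ℂ where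
  obj X := ⟨X.rank⟩
  map F := (FlatSys.matrix F).map (germEval · z₀)
  map_id X := germEval_one X.rank z₀.ne_zero
  map_comp F G := by
    obtain ⟨f, hf⟩ := exists_continues hq F
    obtain ⟨g, hg⟩ := exists_continues hq G
    exact germEval_mul hg hf z₀.ne_zero

lemma fibre_kron {q : ℂˣ} (hq : 1 < ‖(q : ℂ)‖) (z₀ : ℂˣ) {X Y X' Y' : FlatLocal q}
    (F : X ⟶ Y) (G : X' ⟶ Y') :
    (fibre q hq z₀).map (F ⊗ₘ G) = (fibre q hq z₀).map F ⊗ₘ (fibre q hq z₀).map G := by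
  obtain ⟨f, hf⟩ := exists_continues hq F
  obtain ⟨g, hg⟩ := exists_continues hq G
  exact germEval_kron hf hg z₀.ne_zero

/-- The fibre functors are tensor functors, with identities as structural isomorphisms. -/
noncomputable instance (q : ℂˣ) (hq : 1 < ‖(q : ℂ)‖) (z₀ : ℂˣ) : (fibre q hq z₀).Monoidal :=
  Functor.CoreMonoidal.toMonoidal
  { εIso := Iso.refl _
    μIso := fun _ _ => Iso.refl _
    μIso_hom_natural_left := fun F X => by
      refine (Category.comp_id _).trans (Eq.trans ?_ (Category.id_comp _).symm)
      rw [← tensorHom_id, ← tensorHom_id, fibre_kron, CategoryTheory.Functor.map_id]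
    μIso_hom_natural_right := fun X F => by
      refine (Category.comp_id _).trans (Eq.trans ?_ (Category.id_comp _).symm)
      rw [← id_tensorHom, ← id_tensorHom, fibre_kron, CategoryTheory.Functor.map_id]
    associativity := fun X Y Z => by
      have h : (fibre q hq z₀).map (α_ X Y Z).hom =
          permMat ℂ (assocEquiv X.rank Y.rank Z.rank) := germEval_permMat _ z₀.ne_zero
      rw [h]
      exact strict_assoc_aux X.rank Y.rank Z.rank
    left_unitality := fun X => by
      have h : (fibre q hq z₀).map (λ_ X).hom = permMat ℂ (leftEquiv X.rank) :=
        germEval_permMat _ z₀.ne_zero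
      rw [h]
      exact strict_left_aux X.rank
    right_unitality := fun X => by
      have h : (fibre q hq z₀).map (ρ_ X).hom = permMat ℂ (rightEquiv X.rank) :=
        germEval_permMat _ z₀.ne_zero
      rw [h]
      exact strict_right_aux X.rank }

end Germs

section Representations

/-- The tensor category of the finite dimensional complex representations of `ℤ`, in the form of
pairs `(ℂ^n, A)`, `A ∈ GL_n(ℂ)` being the image of `1 ∈ ℤ`; a morphism `(ℂ^n, A) → (ℂ^p, B)` is
an `F ∈ M_{p,n}(ℂ)` with `F A = B F`. -/
abbrev RepZ : Type := FlatSys ℂ (AlgHom.id ℂ ℂ)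

/-- The forgetful functor `(ℂ^n, A) ↦ ℂ^n`, `F ↦ F` on representations of `ℤ`. -/
abbrev forgetZ : RepZ ⥤ MatCat ℂ := toMat ℂ (AlgHom.id ℂ ℂ)

/-- The embedding of the representations of `ℤ` in the flat systems: the identity on
objects, and morphisms are seen as constant matrices. -/
noncomputable def embed (q : ℂˣ) : RepZ ⥤ FlatLocal q where
  obj X := ⟨X.rank, X.A⟩
  map {X Y} F := FlatSys.Hom.mk (constMat MeroGerm (FlatSys.matrix F)) (by
    have h : FlatSys.matrix F * X.A.val = Y.A.val * FlatSys.matrix F := F.comm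
    rw [constMat_map, ← constMat_mul, ← constMat_mul, h])
  map_id X := flatSys_ext (constMat_one X.rank)
  map_comp F G := flatSys_ext (constMat_mul _ _)

/-- `Aut^⊗(ω)`: the group of the automorphisms of the forgetful functor `ω` that are natural and
compatible with tensor products. -/
abbrev TensorAut : Type := Aut (LaxMonoidalFunctor.of forgetZ)

/-- `Iso^⊗(ω_{z₀}, ω_{z₁})`: the natural isomorphisms of the fibre functors at `z₀` and at `z₁`
that are compatible with tensor products. -/
abbrev TensorIso (q : ℂˣ) (hq : 1 < ‖(q : ℂ)‖) (z₀ z₁ : ℂˣ) : Type :=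
  LaxMonoidalFunctor.of (fibre q hq z₀) ≅ LaxMonoidalFunctor.of (fibre q hq z₁)

/-- The restriction of a tensor isomorphism `ω_{z₀} → ω_{z₁}` to the representations of `ℤ`, on
which both fibre functors are the forgetful functor. -/
noncomputable def restrict (q : ℂˣ) (hq : 1 < ‖(q : ℂ)‖) (z₀ z₁ : ℂˣ)
    (η : TensorIso q hq z₀ z₁) : TensorAut :=
  LaxMonoidalFunctor.isoOfComponents
    (fun X =>
      { hom := η.hom.hom.app ((embed q).obj X)
        inv := η.inv.hom.app ((embed q).obj X)
        hom_inv_id := congrArg (fun α => α.hom.app ((embed q).obj X)) η.hom_inv_id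
        inv_hom_id := congrArg (fun α => α.hom.app ((embed q).obj X)) η.inv_hom_id })
    (fun {X Y} F => by
      have h := η.hom.hom.naturality ((embed q).map F)
      have h0 : (fibre q hq z₀).map ((embed q).map F) = FlatSys.matrix F :=
        germEval_constMat _ z₀.ne_zero
      have h1 : (fibre q hq z₁).map ((embed q).map F) = FlatSys.matrix F :=
        germEval_constMat _ z₁.ne_zero
      change (fibre q hq z₀).map ((embed q).map F) ≫ _ =
        _ ≫ (fibre q hq z₁).map ((embed q).map F) at h
      rw [h0, h1] at h
      exact h)
    η.hom.isMonoidal.unit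
    (fun X Y => η.hom.isMonoidal.tensor ((embed q).obj X) ((embed q).obj Y))

end Representations

section ProalgebraicHull

/-- `ℤ^alg = Hom_grp(ℂ^*, ℂ^*) × ℂ`, with the pointwise product of homomorphisms and the
addition of `ℂ`. -/
abbrev ZAlg : Type := (ℂˣ →* ℂˣ) × Multiplicative ℂ

/-- The matrix `Q diag(c₁, …, c_n) Q⁻¹`. -/
noncomputable def conjDiag {n : ℕ} (Q : GL (Fin n) ℂ) (c : Fin n → ℂˣ) :
    Matrix (Fin n) (Fin n) ℂ :=
  Q.val * Matrix.diagonal (fun i => (c i : ℂ)) * (Q⁻¹).val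

/-- The power `U^t = ∑_k binom(t, k) (U - 1)^k` of a unipotent `n × n` matrix `U`; the terms with
`k ≥ n` vanish. -/
noncomputable def unipPow {n : ℕ} (U : Matrix (Fin n) (Fin n) ℂ) (t : ℂ) :
    Matrix (Fin n) (Fin n) ℂ :=
  ∑ k ∈ Finset.range n, Ring.choose t k • (U - 1) ^ k

/-- A (multiplicative) Dunford decomposition `A = S U` of `A ∈ GL_n(ℂ)`, with a diagonalization
`S = Q diag(c₁, …, c_n) Q⁻¹` of the semi-simple factor, and `U` unipotent and commuting with `S`. -/
structure Dunford {n : ℕ} (A : GL (Fin n) ℂ) where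
  /-- a basis of eigenvectors of the semi-simple factor -/
  Q : GL (Fin n) ℂ
  /-- the eigenvalues -/
  c : Fin n → ℂˣ
  /-- the unipotent factor -/
  U : Matrix (Fin n) (Fin n) ℂ
  unipotent : IsNilpotent (U - 1)
  commute : Commute (conjDiag Q c) U
  eq : A.val = conjDiag Q c * U

/-- The matrix `A^(γ, t) = γ(S) U^t`, where `γ(S) = Q diag(γ(c₁), …, γ(c_n)) Q⁻¹`. -/
noncomputable def Dunford.act {n : ℕ} {A : GL (Fin n) ℂ} (D : Dunford A) (g : ZAlg) :
    Matrix (Fin n) (Fin n) ℂ :=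
  conjDiag D.Q (fun i => g.1 (D.c i)) * unipPow D.U g.2.toAdd

/-- A semi-simple complex endomorphism is diagonalizable. -/
lemma exists_diag {n : ℕ} (S : Module.End ℂ (Fin n → ℂ)) (hS : S.IsSemisimple) :
    ∃ (Q : GL (Fin n) ℂ) (μ : Fin n → ℂ),
      LinearMap.toMatrix' S = Q.val * Matrix.diagonal μ * (Q⁻¹).val := by
  classical
  have hint : DirectSum.IsInternal fun μ => S.eigenspace μ :=
    DirectSum.isInternal_submodule_of_iSupIndep_of_iSup_eq_top
      S.eigenspaces_iSupIndep hS.iSup_eigenspace_eq_top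
  let b₀ := hint.collectedBasis fun μ => Module.finBasis ℂ (S.eigenspace μ)
  let b := b₀.reindex (b₀.indexEquiv (Pi.basisFun ℂ (Fin n)))
  let μ : Fin n → ℂ := fun i => ((b₀.indexEquiv (Pi.basisFun ℂ (Fin n))).symm i).1
  have hb : ∀ i, S (b i) = μ i • b i := by
    intro i
    have : b i ∈ S.eigenspace (μ i) := by
      rw [Module.Basis.reindex_apply]
      exact hint.collectedBasis_mem _ _
    exact Module.End.mem_eigenspace_iff.1 this
  let M := (Pi.basisFun ℂ (Fin n)).toMatrix b
  let Q : GL (Fin n) ℂ := ⟨M, b.toMatrix (Pi.basisFun ℂ (Fin n)),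
    Module.Basis.toMatrix_mul_toMatrix_flip _ _, Module.Basis.toMatrix_mul_toMatrix_flip _ _⟩
  refine ⟨Q, μ, ?_⟩
  have h : LinearMap.toMatrix' S * Q.val = Q.val * Matrix.diagonal μ := by
    ext i j
    rw [Matrix.mul_diagonal]
    have h1 := congrFun (hb j) i
    have h2 : Matrix.mulVec (LinearMap.toMatrix' S) (b j) = S (b j) := by
      rw [← Matrix.toLin'_apply, Matrix.toLin'_toMatrix']
    rw [← h2] at h1
    simpa [Matrix.mul_apply, Matrix.mulVec, dotProduct, Q, M, Module.Basis.toMatrix_apply,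
      mul_comm] using h1
  rw [← h, Matrix.mul_assoc, ← Units.val_mul, mul_inv_cancel, Units.val_one, Matrix.mul_one]

/-- Every invertible matrix has a Dunford decomposition. -/
lemma nonempty_dunford {n : ℕ} (A : GL (Fin n) ℂ) : Nonempty (Dunford A) := by
  classical
  obtain ⟨N, hN, S, hS, hNn, hSs, hNS⟩ :=
    Module.End.exists_isNilpotent_isSemisimple (K := ℂ) (f := Matrix.toLin' A.val)
  obtain ⟨Q, μ, hQ⟩ := exists_diag S hSs
  have hcomm : Commute N S := 
    Algebra.commute_of_mem_adjoin_singleton_of_commute hS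
      (Algebra.commute_of_mem_adjoin_self hN).symm
  let T := LinearMap.toMatrix' S
  let N' := LinearMap.toMatrix' N
  have hA : A.val = N' + T := by
    rw [← map_add, ← hNS, LinearMap.toMatrix'_toLin']
  have hc : Commute N' T := hcomm.map (LinearMap.toMatrixAlgEquiv' (R := ℂ) (n := Fin n))
  have hn : IsNilpotent N' := hNn.map (LinearMap.toMatrixAlgEquiv' (R := ℂ) (n := Fin n))
  have hu : IsUnit T := by
    have h1 : T = -N' + A.val := by rw [hA]; abel
    have h2 : Commute (-N') A.val := by
      rw [hA]; exact ((Commute.refl N').add_right hc).neg_left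
    rw [h1]
    exact (hn.neg).isUnit_add_right_of_commute A.isUnit h2
  obtain ⟨t, ht⟩ := hu
  have hμ : ∀ i, μ i ≠ 0 := by
    have h1 : IsUnit (Matrix.diagonal μ) := by
      have : Matrix.diagonal μ = (Q⁻¹ * t * Q).val := by
        rw [Units.val_mul, Units.val_mul, ht]
        change _ = _ * LinearMap.toMatrix' S * _
        rw [hQ]
        simp only [← Matrix.mul_assoc]
        rw [← Units.val_mul, inv_mul_cancel, Units.val_one, Matrix.one_mul, Matrix.mul_assoc,
          ← Units.val_mul, inv_mul_cancel, Units.val_one, Matrix.mul_one]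
      rw [this]
      exact Units.isUnit _
    rw [Matrix.isUnit_diagonal, Pi.isUnit_iff] at h1
    exact fun i => (h1 i).ne_zero
  have hTQ : conjDiag Q (fun i => Units.mk0 (μ i) (hμ i)) = T := hQ.symm
  have hct : Commute N' (t⁻¹).val := (ht ▸ hc : Commute N' t.val).units_inv_right
  refine ⟨⟨Q, fun i => Units.mk0 (μ i) (hμ i), (t⁻¹).val * A.val, ?_, ?_, ?_⟩⟩
  · have : (t⁻¹).val * A.val - 1 = N' * (t⁻¹).val := by
      rw [hA, mul_add, ← ht, ← Units.val_mul, inv_mul_cancel, Units.val_one, add_sub_cancel_right,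
        hct.eq]
    rw [this]
    exact hct.isNilpotent_mul_right hn
  · rw [hTQ, hA, mul_add, ← ht, ← Units.val_mul, inv_mul_cancel, Units.val_one]
    refine Commute.add_right (Commute.mul_right ?_ (ht ▸ hc.symm)) (Commute.one_right _)
    exact (Commute.refl t.val).units_inv_right
  · rw [hTQ, ← ht, ← mul_assoc, ← Units.val_mul, mul_inv_cancel, Units.val_one, one_mul]

end ProalgebraicHull
end LocalGalois

/-!
The semisimple and unipotent factors of the Dunford decomposition are natural for intertwiners, so
that a pair `(γ, t)` acts by a tensor automorphism `A ↦ A^(γ, t)`. A tensor automorphism `η` that is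
trivial on the objects `(ℂ, c)` and on the Jordan block `J₂` is trivial: the morphisms `A ⊗ J₂ → B`
make `η` commute with the grading operator `diag(k)` of the multiples of Jordan blocks, on which its
first row is therefore trivial, and each left eigenvector of the semisimple factor of `A` is the
first row of a morphism from `A` to such a multiple. Since `c ↦ η_{(ℂ, c)}` is a character and
`η_{J₂}` is unipotent, every `η` comes from exactly one pair `(γ, t)`.

Let `F` be a morphism of `q`-difference systems from `A` to `B`, entire after multiplication by a
power of `z`. Its Taylor coefficient `F_k` intertwines `q^k A` with `B`, hence `γ(q)^k A^(γ, t)`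
with `B^(γ, t)`, and summing gives `F(γ(q) z) A^(γ, t) = B^(γ, t) F(z)`: the pairs with
`γ(q) z₀ = z₁` define tensor isomorphisms of the fibre functors. Conversely, the coordinate `z`
is a morphism from `(ℂ, 1)` to `(ℂ, q)`, on which naturality reads `γ(q) z₀ = z₁`.
-/

namespace LocalGalois

open CategoryTheory MonoidalCategory
open scoped Kronecker Matrix Polynomial

section PolynomialFunctions

/-- The algebra of the functions `R → R` given by a polynomial. -/
noncomputable def polyFun (R : Type*) [CommRing R] : Subalgebra R (R → R) :=
  (Polynomial.aeval (R := R) (id : R → R)).range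

lemma mem_polyFun {R : Type*} [CommRing R] {f : R → R} :
    f ∈ polyFun R ↔ ∃ p : Polynomial R, ∀ t, p.eval t = f t := by
  simp only [polyFun, AlgHom.mem_range, funext_iff, Polynomial.aeval_pi_apply, id_eq,
    Polynomial.coe_aeval_eq_eval]

lemma eq_of_mem_polyFun_of_natCast_eq {R : Type*} [CommRing R] [IsDomain R] [CharZero R]
    {f g : R → R} (hf : f ∈ polyFun R) (hg : g ∈ polyFun R) (h : ∀ k : ℕ, f k = g k) : f = g := by
  obtain ⟨p, hp⟩ := mem_polyFun.1 hf
  obtain ⟨r, hr⟩ := mem_polyFun.1 hg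
  have hpr : p = r := by
    refine Polynomial.eq_of_infinite_eval_eq p r
      ((Set.infinite_range_of_injective (Nat.cast_injective (R := R))).mono ?_)
    rintro _ ⟨k, rfl⟩
    rw [Set.mem_ofPred_eq, hp, hr, h]
  funext t
  rw [← hp, ← hr, hpr]

lemma choose_mem_polyFun {K : Type*} [Field K] [CharZero K] (k : ℕ) :
    (fun t : K => Ring.choose t k) ∈ polyFun K := by
  refine mem_polyFun.2 ⟨Polynomial.C ((k.factorial : K)⁻¹) *
    (descPochhammer ℤ k).map (Int.castRingHom K), fun t => ?_⟩
  rw [Ring.choose_eq_smul, Polynomial.eval_mul, Polynomial.eval_C, smul_eq_mul,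
    ← Polynomial.aeval_eq_smeval, Polynomial.eval_map, Polynomial.aeval_def]
  rfl

end PolynomialFunctions

lemma mul_aeval_eq_aeval_mul {R m n : Type*} [CommRing R] [Fintype m] [DecidableEq m] [Fintype n]
    [DecidableEq n] {A : Matrix n n R} {B : Matrix m m R} {F : Matrix m n R}
    (h : F * A = B * F) (p : Polynomial R) :
    F * Polynomial.aeval A p = Polynomial.aeval B p * F := by
  induction p using Polynomial.induction_on with
  | C a => simp only [Polynomial.aeval_C, Algebra.algebraMap_eq_smul_one, Matrix.mul_smul,
      Matrix.smul_mul, Matrix.mul_one, Matrix.one_mul]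
  | add p r hp hr => rw [map_add, map_add, Matrix.mul_add, Matrix.add_mul, hp, hr]
  | monomial k a ih =>
    rw [pow_succ, ← mul_assoc, map_mul _ _ Polynomial.X, map_mul _ _ Polynomial.X,
      Polynomial.aeval_X, Polynomial.aeval_X, ← Matrix.mul_assoc, ih, Matrix.mul_assoc, h,
      Matrix.mul_assoc]

lemma pow_eq_zero_of_isNilpotent {K ι : Type*} [Field K] [Fintype ι] [DecidableEq ι] {k : ℕ}
    {N : Matrix ι ι K} (hN : IsNilpotent N) (hk : Fintype.card ι ≤ k) : N ^ k = 0 := by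
  have hchar := LinearMap.aeval_self_charpoly (Matrix.toLinAlgEquiv' N)
  rw [(hN.map (Matrix.toLinAlgEquiv' (R := K))).charpoly_eq_X_pow_finrank, map_pow,
    Polynomial.aeval_X, Module.finrank_fintype_fun_eq_card, ← map_pow,
    map_eq_zero_iff _ (Matrix.toLinAlgEquiv' (R := K)).injective] at hchar
  exact pow_eq_zero_of_le hk hchar

lemma aeval_trunc_coe {R S : Type*} [CommRing R] [Ring S] [Algebra R S] {x : S} {n : ℕ}
    (hx : x ^ n = 0) (p : Polynomial R) :
    Polynomial.aeval x (PowerSeries.trunc n (p : PowerSeries R)) = Polynomial.aeval x p := by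
  have hdvd : Polynomial.X ^ n ∣ p - PowerSeries.trunc n (p : PowerSeries R) := by
    refine Polynomial.X_pow_dvd_iff.2 fun d hd => ?_
    rw [Polynomial.coeff_sub, PowerSeries.coeff_trunc, if_pos hd, Polynomial.coeff_coe, sub_self]
  obtain ⟨r, hr⟩ := hdvd
  rw [← sub_eq_zero, ← neg_eq_zero, neg_sub, ← map_sub, hr, map_mul, map_pow, Polynomial.aeval_X,
    hx, zero_mul]

section UnipotentPowers

variable {n m : ℕ} {U : Matrix (Fin n) (Fin n) ℂ} {V : Matrix (Fin m) (Fin m) ℂ}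

lemma unipPow_eq_aeval_trunc_binomialSeries (hU : IsNilpotent (U - 1)) (t : ℂ) {r : ℕ}
    (hr : n ≤ r) : unipPow U t =
      Polynomial.aeval (U - 1) (PowerSeries.trunc r (PowerSeries.binomialSeries ℂ t)) := by
  rw [Polynomial.aeval_def, PowerSeries.eval₂_trunc_eq_sum_range, unipPow]
  simp only [PowerSeries.binomialSeries_coeff, smul_eq_mul, mul_one, ← Algebra.smul_def]
  refine Finset.sum_subset (Finset.range_mono hr) fun k _ hk => ?_
  rw [pow_eq_zero_of_isNilpotent hU (by simpa using hk), smul_zero]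

lemma unipPow_natCast (hU : IsNilpotent (U - 1)) (k : ℕ) : unipPow U k = U ^ k := by
  have hcoe : (1 + PowerSeries.X) ^ k =
      (((1 + Polynomial.X) ^ k : Polynomial ℂ) : PowerSeries ℂ) := by simp
  rw [unipPow_eq_aeval_trunc_binomialSeries hU _ le_rfl, PowerSeries.binomialSeries_nat, hcoe,
    aeval_trunc_coe (pow_eq_zero_of_isNilpotent hU (Fintype.card_fin n).le)]
  simp

lemma unipPow_zero (hU : IsNilpotent (U - 1)) : unipPow U 0 = 1 := by
  simpa using unipPow_natCast hU 0

lemma unipPow_add (hU : IsNilpotent (U - 1)) (s t : ℂ) :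
    unipPow U (s + t) = unipPow U s * unipPow U t := by
  simp only [unipPow_eq_aeval_trunc_binomialSeries hU _ le_rfl]
  rw [PowerSeries.binomialSeries_add, ← PowerSeries.trunc_trunc_mul_trunc, ← Polynomial.coe_mul,
    aeval_trunc_coe (pow_eq_zero_of_isNilpotent hU (Fintype.card_fin n).le), map_mul]

lemma unipPow_intertwine (hU : IsNilpotent (U - 1)) (hV : IsNilpotent (V - 1))
    {F : Matrix (Fin m) (Fin n) ℂ} (h : F * U = V * F) (t : ℂ) :
    F * unipPow U t = unipPow V t * F := by
  rw [unipPow_eq_aeval_trunc_binomialSeries hU t (le_max_left n m),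
    unipPow_eq_aeval_trunc_binomialSeries hV t (le_max_right n m)]
  exact mul_aeval_eq_aeval_mul
    (by rw [Matrix.mul_sub, Matrix.sub_mul, h, Matrix.mul_one, Matrix.one_mul]) _

lemma kron_pow {K : Type} [CommRing K] (A : Matrix (Fin n) (Fin n) K) (B : Matrix (Fin m) (Fin m) K)
    (k : ℕ) : kron A B ^ k = kron (A ^ k) (B ^ k) := by
  induction k with
  | zero => rw [pow_zero, pow_zero, pow_zero, kron_one]
  | succ k ih => rw [pow_succ, ih, kron_mul, pow_succ, pow_succ]

lemma isNilpotent_kron_sub_one {K : Type} [CommRing K] {U : Matrix (Fin n) (Fin n) K}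
    {V : Matrix (Fin m) (Fin m) K} (hU : IsNilpotent (U - 1)) (hV : IsNilpotent (V - 1)) :
    IsNilpotent (kron U V - 1) := by
  have hsum : kron U V - 1 = kron (U - 1) V + kron 1 (V - 1) := by
    rw [← kron_one]
    ext i j
    simp only [kron, Matrix.submatrix_apply, Matrix.sub_apply, Matrix.add_apply,
      Matrix.kroneckerMap_apply]
    ring
  rw [hsum]
  refine Commute.isNilpotent_add ?_ ?_ ?_
  · rw [commute_iff_eq, kron_mul, kron_mul, mul_one, one_mul, mul_sub, sub_mul, mul_one, one_mul]
  · obtain ⟨k, hk⟩ := hU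
    exact ⟨k, by rw [kron_pow, hk]; ext; simp [kron]⟩
  · obtain ⟨k, hk⟩ := hV
    exact ⟨k, by rw [kron_pow, hk]; ext; simp [kron]⟩

lemma unipPow_apply_mem_polyFun (U : Matrix (Fin n) (Fin n) ℂ) (i j : Fin n) :
    (fun t => unipPow U t i j) ∈ polyFun ℂ := by
  have hsum : (fun t => unipPow U t i j) =
      ∑ k ∈ Finset.range n, ((U - 1) ^ k) i j • fun t => Ring.choose t k := by
    ext t
    simp only [unipPow, Matrix.sum_apply, Matrix.smul_apply, Finset.sum_apply, Pi.smul_apply,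
      smul_eq_mul, mul_comm]
  rw [hsum]
  exact sum_mem fun k _ => Subalgebra.smul_mem _ (choose_mem_polyFun k) _

lemma unipPow_kron (hU : IsNilpotent (U - 1)) (hV : IsNilpotent (V - 1)) (t : ℂ) :
    unipPow (kron U V) t = kron (unipPow U t) (unipPow V t) := by
  ext i j
  refine congrFun (eq_of_mem_polyFun_of_natCast_eq (unipPow_apply_mem_polyFun _ i j)
    (g := fun t => kron (unipPow U t) (unipPow V t) i j)
    (mul_mem (unipPow_apply_mem_polyFun U _ _) (unipPow_apply_mem_polyFun V _ _)) fun k => ?_) t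
  rw [unipPow_natCast hU, unipPow_natCast hV, unipPow_natCast (isNilpotent_kron_sub_one hU hV),
    kron_pow]

end UnipotentPowers

section SemisimpleFactor

open Module.End in
lemma comp_eq_comp_of_isSemisimple {K V W : Type*} [Field K] [IsAlgClosed K] [AddCommGroup V]
    [Module K V] [FiniteDimensional K V] [AddCommGroup W] [Module K W]
    {a s : Module.End K V} {b t : Module.End K W} {f : V →ₗ[K] W}
    (hs : s.IsSemisimple) (has : Commute a s) (hna : IsNilpotent (a - s))
    (ht : t.IsSemisimple) (hbt : Commute b t) (hnb : IsNilpotent (b - t))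
    (h : f ∘ₗ a = b ∘ₗ f) : f ∘ₗ s = t ∘ₗ f := by
  -- An eigenvector of `s` is a generalized eigenvector of `a`, which `f` sends to a generalized
  -- eigenvector of `b`, and the latter is an eigenvector of `t`.
  ext v
  have hv : v ∈ ⨆ μ, s.eigenspace μ := hs.iSup_eigenspace_eq_top ▸ Submodule.mem_top
  induction hv using Submodule.iSup_induction' with
  | zero => rw [map_zero, map_zero]
  | add v w _ _ hv hw => rw [map_add, map_add, hv, hw]
  | mem μ v hv =>
    obtain ⟨k, hk⟩ := hna
    have hsv : s v = μ • v := mem_eigenspace_iff.1 hv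
    have hav (j : ℕ) : ((a - μ • 1) ^ j) v = ((a - s) ^ j) v := by
      induction j with
      | zero => rfl
      | succ j ih =>
        have hcomm : Commute (a - μ • 1) ((a - s) ^ j) :=
          (((Commute.refl a).sub_right has).sub_left
            ((Commute.one_left (a - s)).smul_left μ)).pow_right j
        rw [pow_succ', Module.End.mul_apply, ih, ← Module.End.mul_apply, hcomm.eq, pow_succ,
          Module.End.mul_apply, Module.End.mul_apply]
        simp [hsv]
    have hbv (j : ℕ) : ((b - μ • 1) ^ j) (f v) = f (((a - μ • 1) ^ j) v) := by
      induction j with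
      | zero => rfl
      | succ j ih =>
        rw [pow_succ', Module.End.mul_apply, ih, pow_succ', Module.End.mul_apply]
        simpa using (LinearMap.congr_fun h (((a - μ • 1) ^ j) v)).symm
    have hfv : f v ∈ b.genEigenspace μ k := mem_genEigenspace_nat.2 <| LinearMap.mem_ker.2 <| by
      rw [hbv, hav, hk, LinearMap.zero_apply, map_zero]
    rw [LinearMap.comp_apply, LinearMap.comp_apply, hsv, map_smul,
      apply_eq_of_mem_of_comm_of_isFinitelySemisimple_of_isNil hfv hbt ht.isFinitelySemisimple hnb]

/-- The algebra homomorphism `d ↦ Q diag(d) Q⁻¹`; unlike `conjDiag` it allows zero entries, so that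
polynomials can be evaluated through it. -/
noncomputable def conjDiagHom {n : ℕ} (Q : GL (Fin n) ℂ) :
    (Fin n → ℂ) →ₐ[ℂ] Matrix (Fin n) (Fin n) ℂ :=
  (MulSemiringAction.toAlgHom ℂ (Matrix (Fin n) (Fin n) ℂ) (ConjAct.toConjAct Q)).comp
    (Matrix.diagonalAlgHom ℂ)

lemma conjDiag_eq {n : ℕ} (Q : GL (Fin n) ℂ) (c : Fin n → ℂˣ) :
    conjDiag Q c = conjDiagHom Q (fun i => (c i : ℂ)) := rfl

lemma isSemisimple_conjDiag {n : ℕ} (Q : GL (Fin n) ℂ) (c : Fin n → ℂˣ) :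
    Module.End.IsSemisimple (Matrix.toLinAlgEquiv' (conjDiag Q c)) := by
  let p : ℂ[X] := ∏ x ∈ Finset.univ.image fun i => (c i : ℂ), (Polynomial.X - Polynomial.C x)
  have hp : p.Separable := Polynomial.separable_prod_X_sub_C_iff'.2 fun _ _ _ _ => id
  refine Module.End.isSemisimple_of_squarefree_aeval_eq_zero hp.squarefree ?_
  have hroot : Polynomial.aeval (fun i => (c i : ℂ)) p = 0 := by
    ext i
    rw [Polynomial.aeval_pi_apply₂, Polynomial.coe_aeval_eq_eval, Polynomial.eval_prod]
    exact Finset.prod_eq_zero (Finset.mem_image_of_mem _ (Finset.mem_univ i)) (by simp)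
  rw [conjDiag_eq, Polynomial.aeval_algHom_apply, Polynomial.aeval_algHom_apply, hroot, map_zero,
    map_zero]

lemma conjDiag_intertwine_map {n p : ℕ} {Q : GL (Fin n) ℂ} {c : Fin n → ℂˣ} {Q' : GL (Fin p) ℂ}
    {c' : Fin p → ℂˣ} {F : Matrix (Fin p) (Fin n) ℂ}
    (h : F * conjDiag Q c = conjDiag Q' c' * F) (γ : ℂˣ → ℂˣ) :
    F * conjDiag Q (fun i => γ (c i)) = conjDiag Q' (fun i => γ (c' i)) * F := by
  let s : Finset ℂˣ := Finset.univ.image c ∪ Finset.univ.image c'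
  let r : ℂ[X] := Lagrange.interpolate s (fun x => (x : ℂ)) (fun x => (γ x : ℂ))
  have hr (x : ℂˣ) (hx : x ∈ s) : r.eval (x : ℂ) = γ x :=
    Lagrange.eval_interpolate_at_node _ Units.val_injective.injOn hx
  have hmap {k : ℕ} (P : GL (Fin k) ℂ) (d : Fin k → ℂˣ) (hd : ∀ i, d i ∈ s) :
      conjDiag P (fun i => γ (d i)) = Polynomial.aeval (conjDiag P d) r := by
    rw [conjDiag_eq, conjDiag_eq, Polynomial.aeval_algHom_apply]
    congr 1
    ext i
    rw [Polynomial.aeval_pi_apply₂, Polynomial.coe_aeval_eq_eval, hr _ (hd i)]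
  rw [hmap Q c (by simp [s]), hmap Q' c' (by simp [s]), mul_aeval_eq_aeval_mul h]

lemma conjDiag_mul {n : ℕ} (Q : GL (Fin n) ℂ) (c d : Fin n → ℂˣ) :
    conjDiag Q (c * d) = conjDiag Q c * conjDiag Q d := by
  simp only [conjDiag_eq, ← map_mul]
  rfl

lemma conjDiag_one {n : ℕ} (Q : GL (Fin n) ℂ) : conjDiag Q 1 = 1 :=
  map_one (conjDiagHom Q)

lemma conjDiag_smul {n : ℕ} (Q : GL (Fin n) ℂ) (u : ℂˣ) (c : Fin n → ℂˣ) :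
    conjDiag Q (u • c) = (u : ℂ) • conjDiag Q c := by
  simp only [conjDiag_eq, ← map_smul]
  rfl

lemma conjDiag_kron {n m : ℕ} (Q : GL (Fin n) ℂ) (c : Fin n → ℂˣ) (R : GL (Fin m) ℂ)
    (d : Fin m → ℂˣ) :
    conjDiag (kronGL Q R) (fun i => c (finProdFinEquiv.symm i).1 * d (finProdFinEquiv.symm i).2) =
      kron (conjDiag Q c) (conjDiag R d) := by
  have hdiag : Matrix.diagonal (fun i => ((c (finProdFinEquiv.symm i).1 *
      d (finProdFinEquiv.symm i).2 : ℂˣ) : ℂ)) =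
      kron (Matrix.diagonal (fun i => (c i : ℂ))) (Matrix.diagonal (fun i => (d i : ℂ))) := by
    rw [kron, Matrix.diagonal_kronecker_diagonal, Matrix.submatrix_diagonal_equiv]
    rfl
  have hinv : ((kronGL Q R)⁻¹).val = kron (Q⁻¹).val (R⁻¹).val := rfl
  have hval : (kronGL Q R).val = kron Q.val R.val := rfl
  rw [conjDiag, hdiag, hinv, hval, kron_mul, kron_mul, conjDiag, conjDiag]

namespace Dunford

variable {n m : ℕ} {A : GL (Fin n) ℂ} {B : GL (Fin m) ℂ}

lemma isNilpotent_sub_conjDiag (D : Dunford A) : IsNilpotent (A.val - conjDiag D.Q D.c) := by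
  have hsub : A.val - conjDiag D.Q D.c = conjDiag D.Q D.c * (D.U - 1) := by
    rw [mul_sub, mul_one, ← D.eq]
  exact hsub ▸ (D.commute.sub_right (Commute.one_right _)).isNilpotent_mul_left D.unipotent

lemma commute_conjDiag (D : Dunford A) : Commute A.val (conjDiag D.Q D.c) := by
  rw [D.eq]
  exact (Commute.refl _).mul_left D.commute.symm

lemma intertwine_semisimple (D : Dunford A) (E : Dunford B) {F : Matrix (Fin m) (Fin n) ℂ}
    (h : F * A.val = B.val * F) : F * conjDiag D.Q D.c = conjDiag E.Q E.c * F := by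
  have hnil {k : ℕ} {C : GL (Fin k) ℂ} (G : Dunford C) : IsNilpotent
      (Matrix.toLinAlgEquiv' C.val - Matrix.toLinAlgEquiv' (conjDiag G.Q G.c)) := by
    rw [← map_sub]
    exact G.isNilpotent_sub_conjDiag.map _
  apply Matrix.toLin'.injective
  rw [Matrix.toLin'_mul, Matrix.toLin'_mul]
  exact comp_eq_comp_of_isSemisimple (isSemisimple_conjDiag D.Q D.c)
    (D.commute_conjDiag.map Matrix.toLinAlgEquiv') (hnil D) (isSemisimple_conjDiag E.Q E.c)
    (E.commute_conjDiag.map Matrix.toLinAlgEquiv') (hnil E)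
    ((Matrix.toLin'_mul _ _).symm.trans ((congrArg Matrix.toLin' h).trans (Matrix.toLin'_mul _ _)))

lemma intertwine_unipotent (D : Dunford A) (E : Dunford B) {F : Matrix (Fin m) (Fin n) ℂ}
    (h : F * A.val = B.val * F) : F * D.U = E.U * F := by
  have hinv : conjDiag E.Q E.c⁻¹ * conjDiag E.Q E.c = 1 := by
    rw [← conjDiag_mul, inv_mul_cancel, conjDiag_one]
  have hcancel : conjDiag E.Q E.c * (F * D.U) = conjDiag E.Q E.c * (E.U * F) := by
    rw [← Matrix.mul_assoc, ← D.intertwine_semisimple E h, Matrix.mul_assoc, ← D.eq, h, E.eq,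
      Matrix.mul_assoc]
  simpa only [← Matrix.mul_assoc, hinv, Matrix.one_mul] using
    congrArg (conjDiag E.Q E.c⁻¹ * ·) hcancel

lemma act_intertwine (D : Dunford A) (E : Dunford B) {F : Matrix (Fin m) (Fin n) ℂ}
    (h : F * A.val = B.val * F) (g : ZAlg) : F * D.act g = E.act g * F := by
  rw [act, act, ← Matrix.mul_assoc, conjDiag_intertwine_map (D.intertwine_semisimple E h),
    Matrix.mul_assoc, unipPow_intertwine D.unipotent E.unipotent (D.intertwine_unipotent E h),
    Matrix.mul_assoc]

lemma act_eq_act (D E : Dunford A) (g : ZAlg) : D.act g = E.act g := by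
  simpa only [Matrix.one_mul, Matrix.mul_one] using
    D.act_intertwine E (F := 1) (by rw [Matrix.one_mul, Matrix.mul_one]) g

lemma act_one (D : Dunford A) : D.act 1 = 1 := by
  have hS : conjDiag D.Q (fun i => (1 : ZAlg).1 (D.c i)) = 1 := conjDiag_one D.Q
  have hU : unipPow D.U (1 : ZAlg).2.toAdd = 1 := unipPow_zero D.unipotent
  rw [act, hS, hU, mul_one]

lemma act_mul (D : Dunford A) (g h : ZAlg) : D.act (g * h) = D.act g * D.act h := by
  have hS : conjDiag D.Q (fun i => (g * h).1 (D.c i)) =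
      conjDiag D.Q (fun i => g.1 (D.c i)) * conjDiag D.Q (fun i => h.1 (D.c i)) :=
    conjDiag_mul D.Q _ _
  have hU : unipPow D.U (g * h).2.toAdd = unipPow D.U g.2.toAdd * unipPow D.U h.2.toAdd :=
    unipPow_add D.unipotent _ _
  have hSU : Commute (conjDiag D.Q (fun i => h.1 (D.c i))) (unipPow D.U g.2.toAdd) :=
    unipPow_intertwine D.unipotent D.unipotent
      (conjDiag_intertwine_map D.commute.symm.eq h.1).symm _
  rw [act, act, act, hS, hU, hSU.mul_mul_mul_comm]

/-- The tensor product of two Dunford decompositions. -/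
noncomputable def tensor (D : Dunford A) (E : Dunford B) : Dunford (kronGL A B) where
  Q := kronGL D.Q E.Q
  c i := D.c (finProdFinEquiv.symm i).1 * E.c (finProdFinEquiv.symm i).2
  U := kron D.U E.U
  unipotent := isNilpotent_kron_sub_one D.unipotent E.unipotent
  commute := by
    rw [conjDiag_kron, commute_iff_eq, kron_mul, kron_mul, D.commute.eq, E.commute.eq]
  eq := by
    rw [conjDiag_kron, kron_mul, ← D.eq, ← E.eq]
    rfl

lemma tensor_act (D : Dunford A) (E : Dunford B) (g : ZAlg) :
    (D.tensor E).act g = kron (D.act g) (E.act g) := by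
  rw [act, act, act, ← kron_mul, ← conjDiag_kron, ← unipPow_kron D.unipotent E.unipotent]
  simp only [tensor, map_mul]

/-- The Dunford decomposition of a scalar multiple. -/
noncomputable def smul (D : Dunford A) (u : ℂˣ) : Dunford (u • A) where
  Q := D.Q
  c := u • D.c
  U := D.U
  unipotent := D.unipotent
  commute := by
    rw [conjDiag_smul]
    exact D.commute.smul_left _
  eq := by
    rw [conjDiag_smul, Matrix.smul_mul, ← D.eq]
    rfl

lemma smul_act (D : Dunford A) (u : ℂˣ) (g : ZAlg) :
    (D.smul u).act g = (g.1 u : ℂ) • D.act g := by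
  have hS : (fun i => g.1 ((D.smul u).c i)) = g.1 u • fun i => g.1 (D.c i) :=
    funext fun i => map_mul g.1 u (D.c i)
  rw [act, hS, smul, conjDiag_smul, Matrix.smul_mul, act]

/-- A unipotent matrix is its own unipotent factor. -/
noncomputable def ofUnipotent (hA : IsNilpotent (A.val - 1)) : Dunford A where
  Q := 1
  c := 1
  U := A.val
  unipotent := hA
  commute := by
    rw [conjDiag_one]
    exact Commute.one_left _
  eq := by rw [conjDiag_one, one_mul]

lemma ofUnipotent_act (hA : IsNilpotent (A.val - 1)) (g : ZAlg) :
    (ofUnipotent hA).act g = unipPow A.val g.2.toAdd := by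
  have hS : (fun i => g.1 ((ofUnipotent hA).c i)) = 1 := funext fun _ => map_one g.1
  rw [act, hS, conjDiag_one, one_mul, ofUnipotent]

end Dunford
end SemisimpleFactor

section TensorAutomorphisms

/-- The matrix `A^(γ, t)`, computed from any Dunford decomposition of `A`. -/
noncomputable def actMat (g : ZAlg) {n : ℕ} (A : GL (Fin n) ℂ) : Matrix (Fin n) (Fin n) ℂ :=
  (nonempty_dunford A).some.act g

variable {n m : ℕ} (A : GL (Fin n) ℂ) (B : GL (Fin m) ℂ) (g h : ZAlg)

lemma Dunford.act_eq_actMat {A : GL (Fin n) ℂ} (D : Dunford A) : D.act g = actMat g A :=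
  D.act_eq_act _ g

lemma actMat_one : actMat 1 A = 1 := Dunford.act_one _

lemma actMat_mul : actMat (g * h) A = actMat g A * actMat h A := Dunford.act_mul _ g h

lemma actMat_inv_mul : actMat g⁻¹ A * actMat g A = 1 :=
  ((actMat_mul A g⁻¹ g).symm.trans (congrArg (actMat · A) (inv_mul_cancel g))).trans (actMat_one A)

lemma actMat_intertwine {A : GL (Fin n) ℂ} {B : GL (Fin m) ℂ} {F : Matrix (Fin m) (Fin n) ℂ}
    (hF : F * A.val = B.val * F) : F * actMat g A = actMat g B * F :=
  Dunford.act_intertwine _ _ hF g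

lemma actMat_kronGL : actMat g (kronGL A B) = kron (actMat g A) (actMat g B) := by
  rw [← Dunford.act_eq_actMat g ((nonempty_dunford A).some.tensor (nonempty_dunford B).some),
    Dunford.tensor_act]
  rfl

lemma actMat_smul (u : ℂˣ) : actMat g (u • A) = (g.1 u : ℂ) • actMat g A := by
  rw [← Dunford.act_eq_actMat g ((nonempty_dunford A).some.smul u), Dunford.smul_act]
  rfl

lemma actMat_eq_unipPow {A : GL (Fin n) ℂ} (hA : IsNilpotent (A.val - 1)) :
    actMat g A = unipPow A.val g.2.toAdd := by
  rw [← (Dunford.ofUnipotent hA).act_eq_actMat, Dunford.ofUnipotent_act]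

lemma actMat_one_right : actMat g (1 : GL (Fin 1) ℂ) = 1 := by
  rw [actMat_eq_unipPow g (by simp), unipPow]
  simp

/-- The automorphism of `ℂ^n` given by `A^(γ, t)`. -/
noncomputable def actIso : (⟨n⟩ : MatCat ℂ) ≅ ⟨n⟩ where
  hom := actMat g A
  inv := actMat g⁻¹ A
  hom_inv_id := actMat_inv_mul A g
  inv_hom_id := mul_eq_one_comm.1 (actMat_inv_mul A g)

lemma actMat_unit : actMat g (1 : GL (Fin 1) ℂ) * (1 : Matrix (Fin 1) (Fin 1) ℂ) = 1 := by
  rw [actMat_one_right, Matrix.one_mul]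

lemma actMat_tensor :
    actMat g (kronGL A B) * 1 = 1 * kron (actMat g A) (actMat g B) := by
  rw [actMat_kronGL, Matrix.one_mul, Matrix.mul_one]

/-- The tensor automorphism of the forgetful functor given by `(γ, t)`. -/
noncomputable def actAut : TensorAut :=
  LaxMonoidalFunctor.isoOfComponents (fun X => actIso X.A g)
    (fun F => (actMat_intertwine g F.comm).symm) (actMat_unit g)
    (fun X Y => actMat_tensor X.A Y.A g)

namespace TensorAut

/-- The component at `(ℂ^n, A)` of a tensor automorphism. -/
def mat (η : TensorAut) {n : ℕ} (A : GL (Fin n) ℂ) : Matrix (Fin n) (Fin n) ℂ :=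
  η.hom.hom.app (⟨n, A⟩ : RepZ)

lemma ext_mat {η θ : TensorAut}
    (h : ∀ (n : ℕ) (A : GL (Fin n) ℂ), mat η A = mat θ A) : η = θ := by
  refine Iso.ext (LaxMonoidalFunctor.hom_ext (NatTrans.ext (funext fun X => ?_)))
  exact h X.rank X.A

variable (η θ : TensorAut)

lemma mat_intertwine {A : GL (Fin n) ℂ} {B : GL (Fin m) ℂ} {F : Matrix (Fin m) (Fin n) ℂ}
    (h : F * A.val = B.val * F) : F * mat η A = mat η B * F :=
  (η.hom.hom.naturality (FlatSys.Hom.mk F h : (⟨n, A⟩ : RepZ) ⟶ ⟨m, B⟩)).symm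

lemma mat_one_right : mat η (1 : GL (Fin 1) ℂ) = 1 := by
  have h : mat η (1 : GL (Fin 1) ℂ) * (1 : Matrix (Fin 1) (Fin 1) ℂ) = 1 :=
    η.hom.isMonoidal.unit
  rwa [Matrix.mul_one] at h

lemma mat_kronGL : mat η (kronGL A B) = kron (mat η A) (mat η B) := by
  have h : mat η (kronGL A B) * (1 : Matrix (Fin (n * m)) (Fin (n * m)) ℂ) =
      1 * kron (mat η A) (mat η B) :=
    η.hom.isMonoidal.tensor (⟨n, A⟩ : RepZ) ⟨m, B⟩
  rwa [Matrix.mul_one, Matrix.one_mul] at h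

lemma mat_mul : mat (η * θ) A = mat η A * mat θ A := rfl

end TensorAut

/-- The homomorphism `ℤ^alg → Aut^⊗(ω)`. -/
noncomputable def actHom : ZAlg →* TensorAut where
  toFun := actAut
  map_one' := TensorAut.ext_mat fun _ A => actMat_one A
  map_mul' g h := TensorAut.ext_mat fun _ A => actMat_mul A g h

end TensorAutomorphisms

section Generators

/-- The unipotent Jordan block of size `d`, with ones above the diagonal. -/
noncomputable def jordanGL (K : Type*) [Field K] (d : ℕ) : GL (Fin d) K :=
  Matrix.GeneralLinearGroup.mkOfDetNeZero
    (Matrix.of fun i j => if i = j then 1 else if i.val + 1 = j.val then 1 else 0) (by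
      rw [Matrix.det_of_isUpperTriangular fun i j (hij : j < i) => ?_]
      · simp
      · have hne : i.val + 1 ≠ j.val := by omega
        rw [Matrix.of_apply, if_neg hij.ne', if_neg hne])

lemma jordanGL_apply {K : Type*} [Field K] {d : ℕ} (i j : Fin d) :
    (jordanGL K d).val i j = if i = j then 1 else if i.val + 1 = j.val then 1 else 0 := rfl

lemma jordanGL_mul_apply {K ι : Type*} [Field K] {d : ℕ} (G : ℕ → ι → K) (hG : G d = 0)
    (k : Fin d) (j : ι) :
    ((jordanGL K d).val * Matrix.of fun k : Fin d => G k) k j = G k j + G (k + 1) j := by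
  simp only [Matrix.mul_apply, jordanGL_apply, Matrix.of_apply, ite_mul, one_mul, zero_mul]
  have hsplit (l : Fin d) : (if k = l then G l j else if k.val + 1 = l.val then G l j else 0) =
      (if k = l then G k j else 0) + if k.val + 1 = l.val then G (k + 1) j else 0 := by
    grind
  simp only [hsplit, Finset.sum_add_distrib, Finset.sum_ite_eq, Finset.mem_univ, if_true]
  congr 1
  by_cases hk : k.val + 1 < d
  · rw [Finset.sum_eq_single ⟨k + 1, hk⟩ (fun l _ hl => if_neg fun h => hl (Fin.ext h.symm))
      (fun h => absurd (Finset.mem_univ _) h), if_pos rfl]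
  · have hd : k.val + 1 = d := by omega
    rw [hd, hG, Finset.sum_eq_zero fun l _ => if_neg (by omega), Pi.zero_apply]

lemma sub_one_add_diagonal_mul_jordanGL (K : Type*) [Field K] (d : ℕ) :
    (jordanGL K d).val - 1 + Matrix.diagonal (fun k : Fin d => (k.val : K)) * (jordanGL K d).val =
      (jordanGL K d).val * Matrix.diagonal fun k : Fin d => (k.val : K) := by
  ext i j
  simp only [Matrix.add_apply, Matrix.sub_apply, Matrix.diagonal_mul, Matrix.mul_diagonal,
    jordanGL_apply, Matrix.one_apply]
  split_ifs with hij hj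
  · simp [hij]
  · rw [← hj]
    push_cast
    ring
  · simp

/-- The matrix in blocks `(G₀, G₁)`, its columns being indexed as those of `kron G C` for a matrix
`C` with two columns. -/
def blockRow {K : Type*} {p n : ℕ} (G₀ G₁ : Matrix (Fin p) (Fin n) K) :
    Matrix (Fin p) (Fin (n * 2)) K :=
  Matrix.of fun i j => ![G₀, G₁] (finProdFinEquiv.symm j).2 i (finProdFinEquiv.symm j).1

lemma blockRow_apply {K : Type*} {p n : ℕ} (G₀ G₁ : Matrix (Fin p) (Fin n) K) (i : Fin p)
    (j : Fin n) (b : Fin 2) : blockRow G₀ G₁ i (finProdFinEquiv (j, b)) = ![G₀, G₁] b i j := by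
  rw [blockRow, Matrix.of_apply, Equiv.symm_apply_apply]

lemma blockRow_mul_kron {K : Type} [CommRing K] {p n m : ℕ} (G₀ G₁ : Matrix (Fin p) (Fin n) K)
    (A : Matrix (Fin n) (Fin m) K) (C : Matrix (Fin 2) (Fin 2) K) :
    blockRow G₀ G₁ * kron A C = blockRow (C 0 0 • (G₀ * A) + C 1 0 • (G₁ * A))
      (C 0 1 • (G₀ * A) + C 1 1 • (G₁ * A)) := by
  ext i j
  obtain ⟨⟨j, b⟩, rfl⟩ := finProdFinEquiv.surjective j
  simp only [Matrix.mul_apply, ← finProdFinEquiv.sum_comp, Fintype.sum_prod_type, blockRow_apply,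
    kron, Matrix.submatrix_apply, Matrix.kroneckerMap_apply, Equiv.symm_apply_apply,
    Fin.sum_univ_two, Finset.sum_add_distrib]
  fin_cases b <;> simp [Matrix.mul_apply, Finset.mul_sum, mul_comm, mul_assoc]

lemma mul_blockRow {K : Type*} [CommRing K] {p r n : ℕ} (B : Matrix (Fin r) (Fin p) K)
    (G₀ G₁ : Matrix (Fin p) (Fin n) K) :
    B * blockRow G₀ G₁ = blockRow (B * G₀) (B * G₁) := by
  ext i j
  obtain ⟨⟨j, b⟩, rfl⟩ := finProdFinEquiv.surjective j
  simp only [Matrix.mul_apply, blockRow_apply]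
  fin_cases b <;> rfl

lemma blockRow_inj {K : Type*} {p n : ℕ} {G₀ G₁ H₀ H₁ : Matrix (Fin p) (Fin n) K} :
    blockRow G₀ G₁ = blockRow H₀ H₁ ↔ G₀ = H₀ ∧ G₁ = H₁ := by
  have key (b : Fin 2) (h : blockRow G₀ G₁ = blockRow H₀ H₁) : ![G₀, G₁] b = ![H₀, H₁] b := by
    ext i j
    rw [← blockRow_apply, h, blockRow_apply]
  exact ⟨fun h => ⟨key 0 h, key 1 h⟩, fun ⟨h₀, h₁⟩ => h₀ ▸ h₁ ▸ rfl⟩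

namespace TensorAut

variable {η : TensorAut} {n m : ℕ} {A : GL (Fin n) ℂ} {B : GL (Fin m) ℂ}

-- The hypotheses say that `(G₀, G₁)` is a morphism from `A ⊗ J₂` to `B`.
lemma mul_mat_of_mat_jordanGL_two (h₂ : mat η (jordanGL ℂ 2) = 1) {G₀ G₁ : Matrix (Fin m) (Fin n) ℂ}
    (hG₀ : G₀ * A.val = B.val * G₀) (hG₁ : G₀ * A.val + G₁ * A.val = B.val * G₁) :
    G₁ * mat η A = mat η B * G₁ := by
  have hmor : blockRow G₀ G₁ * (kronGL A (jordanGL ℂ 2)).val = B.val * blockRow G₀ G₁ := by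
    refine (blockRow_mul_kron _ _ _ _).trans ?_
    rw [mul_blockRow, blockRow_inj]
    simp [jordanGL_apply, ← hG₁, hG₀]
  have h := mat_intertwine η hmor
  rw [mat_kronGL, h₂, blockRow_mul_kron, mul_blockRow, blockRow_inj] at h
  simpa using h.2

-- The grading `diag(k)` completes `1 - J⁻¹` to a morphism from `c J ⊗ J₂` to `c J`.
lemma diagonal_comm_mat_smul_jordanGL (h₂ : mat η (jordanGL ℂ 2) = 1) (c : ℂˣ) (d : ℕ) :
    Matrix.diagonal (fun k : Fin d => (k.val : ℂ)) * mat η (c • jordanGL ℂ d) =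
      mat η (c • jordanGL ℂ d) * Matrix.diagonal fun k : Fin d => (k.val : ℂ) := by
  set J := jordanGL ℂ d
  refine mul_mat_of_mat_jordanGL_two h₂ (G₀ := 1 - (J⁻¹).val) ?_ ?_
  · rw [Units.val_smul, Matrix.mul_smul, Matrix.smul_mul, Matrix.sub_mul, Matrix.mul_sub, J.inv_mul,
      J.mul_inv, Matrix.one_mul, Matrix.mul_one]
  · rw [Units.val_smul, Matrix.mul_smul, Matrix.mul_smul, Matrix.smul_mul, ← smul_add,
      Matrix.sub_mul, J.inv_mul, Matrix.one_mul, sub_one_add_diagonal_mul_jordanGL]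

lemma mat_smul_jordanGL_zero (h₁ : ∀ c : ℂˣ, mat η (c • (1 : GL (Fin 1) ℂ)) = 1)
    (h₂ : mat η (jordanGL ℂ 2) = 1) (c : ℂˣ) (d : ℕ) :
    mat η (c • jordanGL ℂ (d + 1)) 0 = Pi.single 0 1 := by
  let e : Matrix (Fin (d + 1)) (Fin 1) ℂ := Matrix.of fun i _ => if i = 0 then 1 else 0
  have he : e * (c • (1 : GL (Fin 1) ℂ)).val = (c • jordanGL ℂ (d + 1)).val * e := by
    ext i j
    obtain rfl := Subsingleton.elim j 0
    simp [e, Matrix.mul_apply, Units.smul_def, jordanGL_apply]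
  have hfix := mat_intertwine η he
  rw [h₁, Matrix.mul_one] at hfix
  ext j
  by_cases hj : j = 0
  · simpa [e, Matrix.mul_apply, hj] using (congrFun (congrFun hfix 0) 0).symm
  · have h := congrFun (congrFun (diagonal_comm_mat_smul_jordanGL h₂ c (d + 1)) 0) j
    rw [Matrix.diagonal_mul, Matrix.mul_diagonal] at h
    rw [Pi.single_eq_of_ne hj]
    simpa [hj] using h

end TensorAut

namespace Dunford

variable {n : ℕ} {A : GL (Fin n) ℂ} (D : Dunford A)

/-- The matrix with rows `ℓ (U - 1) ^ k`, where `ℓ` is the row of index `i` of `Q⁻¹`, a left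
eigenvector of the semisimple factor: a morphism from `A` to a multiple of a Jordan block. -/
noncomputable def string (i : Fin n) : Matrix (Fin (n + 1)) (Fin n) ℂ :=
  Matrix.of fun k j => ((D.Q⁻¹).val * (D.U - 1) ^ k.val) i j

lemma string_zero (i : Fin n) : D.string i 0 = (D.Q⁻¹).val i := by
  ext j
  rw [string, Matrix.of_apply, Fin.val_zero, pow_zero, Matrix.mul_one]

lemma inv_mul_pow_mul (i : Fin n) (k : ℕ) :
    ((D.Q⁻¹).val * (D.U - 1) ^ k * A.val) i = (D.c i : ℂ) •
      (((D.Q⁻¹).val * (D.U - 1) ^ k) i + ((D.Q⁻¹).val * (D.U - 1) ^ (k + 1)) i) := by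
  have hQ : (D.Q⁻¹).val * conjDiag D.Q D.c =
      Matrix.diagonal (fun i => (D.c i : ℂ)) * (D.Q⁻¹).val := by
    rw [conjDiag, ← Matrix.mul_assoc, ← Matrix.mul_assoc, D.Q.inv_mul, Matrix.one_mul]
  have hcomm : Commute ((D.U - 1) ^ k) (conjDiag D.Q D.c) :=
    ((D.commute.sub_right (Commute.one_right _)).pow_right k).symm
  have hU : (D.U - 1) ^ k * D.U = (D.U - 1) ^ k + (D.U - 1) ^ (k + 1) := by
    rw [pow_succ, mul_sub, mul_one, add_sub_cancel]
  have hmul : (D.Q⁻¹).val * (D.U - 1) ^ k * A.val = Matrix.diagonal (fun i => (D.c i : ℂ)) *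
      ((D.Q⁻¹).val * (D.U - 1) ^ k + (D.Q⁻¹).val * (D.U - 1) ^ (k + 1)) := by
    rw [← Matrix.mul_add, ← hU, ← Matrix.mul_assoc, ← hQ, D.eq, Matrix.mul_assoc, Matrix.mul_assoc,
      ← Matrix.mul_assoc _ _ D.U, hcomm.eq, Matrix.mul_assoc]
  ext j
  rw [hmul, Matrix.diagonal_mul]
  rfl

lemma string_intertwine (i : Fin n) :
    D.string i * A.val = (D.c i • jordanGL ℂ (n + 1)).val * D.string i := by
  let G (k : ℕ) : Fin n → ℂ := ((D.Q⁻¹).val * (D.U - 1) ^ k) i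
  have hG : G (n + 1) = 0 := by
    change ((D.Q⁻¹).val * (D.U - 1) ^ (n + 1)) i = 0
    rw [pow_eq_zero_of_isNilpotent D.unipotent ((Fintype.card_fin n).le.trans n.le_succ),
      Matrix.mul_zero]
    rfl
  ext k j
  rw [Units.val_smul, Matrix.smul_mul, Matrix.smul_apply]
  refine (congrFun (D.inv_mul_pow_mul i k) j).trans ?_
  exact congrArg ((D.c i : ℂ) * ·) (jordanGL_mul_apply G hG k j).symm

end Dunford

namespace TensorAut

lemma eq_one_of_mat_eq_one {η : TensorAut} (h₁ : ∀ c : ℂˣ, mat η (c • (1 : GL (Fin 1) ℂ)) = 1)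
    (h₂ : mat η (jordanGL ℂ 2) = 1) : η = 1 := by
  refine ext_mat fun n A => ?_
  obtain ⟨D⟩ := nonempty_dunford A
  have hQ : (D.Q⁻¹).val * mat η A = (D.Q⁻¹).val := by
    ext i j
    have h := congrFun (congrFun (mat_intertwine η (D.string_intertwine i)) 0) j
    rw [Matrix.mul_apply, Matrix.mul_apply, mat_smul_jordanGL_zero h₁ h₂, D.string_zero] at h
    simpa [Pi.single_apply, D.string_zero, ← Matrix.mul_apply] using h
  exact (D.Q⁻¹).isUnit.mul_left_cancel (hQ.trans (Matrix.mul_one _).symm)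

lemma mat_jordanGL_two (η : TensorAut) :
    mat η (jordanGL ℂ 2) = !![1, mat η (jordanGL ℂ 2) 0 1; 0, 1] := by
  have hinc : !![(1 : ℂ); 0] * (1 : GL (Fin 1) ℂ).val = (jordanGL ℂ 2).val * !![(1 : ℂ); 0] := by
    ext i j
    fin_cases i <;> fin_cases j <;> simp [jordanGL_apply, Matrix.mul_apply]
  have hproj : !![(0 : ℂ), 1] * (jordanGL ℂ 2).val = (1 : GL (Fin 1) ℂ).val * !![(0 : ℂ), 1] := by
    ext i j
    fin_cases i
    fin_cases j <;> simp [jordanGL_apply, Matrix.mul_apply]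
  have hcol := mat_intertwine η hinc
  have hrow := mat_intertwine η hproj
  rw [mat_one_right] at hcol hrow
  have h₀₀ : mat η (jordanGL ℂ 2) 0 0 = 1 := by
    simpa [Matrix.mul_apply] using (congrFun (congrFun hcol 0) 0).symm
  have h₁₀ : mat η (jordanGL ℂ 2) 1 0 = 0 := by
    simpa [Matrix.mul_apply] using (congrFun (congrFun hcol 1) 0).symm
  have h₁₁ : mat η (jordanGL ℂ 2) 1 1 = 1 := by
    simpa [Matrix.mul_apply] using congrFun (congrFun hrow 0) 1
  ext i j
  fin_cases i <;> fin_cases j <;> simp [h₀₀, h₁₀, h₁₁]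

lemma kronGL_smul_one (c d : ℂˣ) :
    kronGL (c • (1 : GL (Fin 1) ℂ)) (d • (1 : GL (Fin 1) ℂ)) = (c * d) • (1 : GL (Fin 1) ℂ) := by
  refine Units.ext (Matrix.ext fun i j => ?_)
  obtain rfl : i = 0 := Subsingleton.elim (α := Fin 1) _ _
  obtain rfl : j = 0 := Subsingleton.elim (α := Fin 1) _ _
  change kron (c • (1 : Matrix (Fin 1) (Fin 1) ℂ)) (d • (1 : Matrix (Fin 1) (Fin 1) ℂ)) 0 0 =
    ((c * d) • (1 : Matrix (Fin 1) (Fin 1) ℂ)) 0 0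
  simp [kron, Units.smul_def]

/-- The character `c ↦ η_{(ℂ, c)}` of `ℂˣ` defined by a tensor automorphism `η`. -/
noncomputable def character (η : TensorAut) : ℂˣ →* ℂˣ :=
  MonoidHom.toHomUnits
    { toFun := fun c => mat η (c • (1 : GL (Fin 1) ℂ)) 0 0
      map_one' := by rw [one_smul, mat_one_right, Matrix.one_apply_eq]
      map_mul' := fun c d => by
        have h := mat_kronGL (c • (1 : GL (Fin 1) ℂ)) (d • (1 : GL (Fin 1) ℂ)) η
        rw [kronGL_smul_one] at h
        exact congrFun (congrFun h 0) 0 }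

lemma mat_smul_one (η : TensorAut) (c : ℂˣ) :
    mat η (c • (1 : GL (Fin 1) ℂ)) = (character η c : ℂ) • 1 := by
  ext i j
  obtain rfl := Subsingleton.elim i 0
  obtain rfl := Subsingleton.elim j 0
  rw [Matrix.smul_apply, Matrix.one_apply_eq, smul_eq_mul, mul_one]
  rfl

end TensorAut

lemma actMat_smul_one (g : ZAlg) (c : ℂˣ) :
    actMat g (c • (1 : GL (Fin 1) ℂ)) = (g.1 c : ℂ) • 1 := by
  rw [actMat_smul, actMat_one_right]

lemma character_actAut (g : ZAlg) : TensorAut.character (actAut g) = g.1 := by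
  refine MonoidHom.ext fun c => Units.ext ?_
  have hc : TensorAut.character (actAut g) c = actMat g (c • (1 : GL (Fin 1) ℂ)) 0 0 := rfl
  rw [hc, actMat_smul_one, Matrix.smul_apply, Matrix.one_apply_eq, smul_eq_mul, mul_one]

lemma isNilpotent_jordanGL_two_sub_one : IsNilpotent ((jordanGL ℂ 2).val - 1) := by
  refine ⟨2, ?_⟩
  ext i j
  fin_cases i <;> fin_cases j <;> simp [jordanGL_apply, pow_two, Matrix.mul_apply]

lemma actMat_jordanGL_two (g : ZAlg) : actMat g (jordanGL ℂ 2) = !![1, g.2.toAdd; 0, 1] := by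
  rw [actMat_eq_unipPow g isNilpotent_jordanGL_two_sub_one]
  ext i j
  fin_cases i <;> fin_cases j <;> simp [unipPow, Finset.sum_range_succ, jordanGL_apply]

lemma actHom_injective : Function.Injective actHom := by
  intro g h hgh
  have hγ : g.1 = h.1 := by
    rw [← character_actAut g, ← character_actAut h]
    exact congrArg TensorAut.character hgh
  have hJ : actMat g (jordanGL ℂ 2) = actMat h (jordanGL ℂ 2) :=
    congrArg (fun η => TensorAut.mat η (jordanGL ℂ 2)) hgh
  rw [actMat_jordanGL_two, actMat_jordanGL_two] at hJ
  exact Prod.ext hγ (Multiplicative.toAdd.injective (by simpa using congrFun (congrFun hJ 0) 1))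

lemma actHom_surjective : Function.Surjective actHom := by
  intro η
  let g : ZAlg := (TensorAut.character η, Multiplicative.ofAdd (TensorAut.mat η (jordanGL ℂ 2) 0 1))
  have hcancel {n : ℕ} {A : GL (Fin n) ℂ} (h : TensorAut.mat η A = actMat g A) :
      TensorAut.mat ((actHom g)⁻¹ * η) A = 1 := by
    rw [← map_inv, TensorAut.mat_mul, h]
    exact actMat_inv_mul A g
  refine ⟨g, inv_mul_eq_one.1 (TensorAut.eq_one_of_mat_eq_one (fun c => hcancel ?_) (hcancel ?_))⟩
  · rw [TensorAut.mat_smul_one, actMat_smul_one]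
  · rw [TensorAut.mat_jordanGL_two, actMat_jordanGL_two]
    rfl

/-- The identification of `ℤ^alg` with the tensor automorphisms of the forgetful functor. -/
noncomputable def actEquiv : ZAlg ≃* TensorAut :=
  MulEquiv.ofBijective actHom ⟨actHom_injective, actHom_surjective⟩

end Generators

section LocalFibres

open Filter Topology

lemma Continues.sigmaQ {u : MeroGerm} {f : ℂ → ℂ} (h : Continues u f) (q : ℂˣ) :
    Continues (LocalGalois.sigmaQ q u) (fun z => f (q * z)) := by
  refine ⟨fun z hz => (h.1 _ (mul_ne_zero q.ne_zero hz)).fun_comp (by fun_prop), ?_⟩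
  obtain ⟨u, hu⟩ := u
  obtain ⟨-, rfl⟩ := h
  rfl

lemma Continues.meromorphicAt {u : MeroGerm} {f : ℂ → ℂ} (h : Continues u f) :
    MeromorphicAt f 0 := by
  obtain ⟨f', hf', he⟩ := u.2
  exact hf'.congr (Germ.coe_eq.1 (he.trans h.2.symm))

lemma Continues.eventually_differentiable {u : MeroGerm} {f : ℂ → ℂ} (h : Continues u f) :
    ∀ᶠ M in atTop, Differentiable ℂ fun z => z ^ M * f z := by
  obtain ⟨n, hn⟩ := h.meromorphicAt
  filter_upwards [eventually_ge_atTop n] with M hM z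
  obtain rfl | hz := eq_or_ne z 0
  · have hfactor : (fun z : ℂ => z ^ M * f z) = fun z => z ^ (M - n) * ((z - 0) ^ n • f z) := by
      funext z
      rw [sub_zero, smul_eq_mul, ← mul_assoc, ← pow_add, Nat.sub_add_cancel hM]
    rw [hfactor]
    exact (AnalyticAt.mul (by fun_prop) hn).differentiableAt
  · exact (AnalyticAt.mul (by fun_prop) (h.1 z hz)).differentiableAt

section Entire

variable {E E' : Type*} [NormedAddCommGroup E] [NormedSpace ℂ E] [CompleteSpace E]
  [NormedAddCommGroup E'] [NormedSpace ℂ E']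

lemma comp_const_mul_eq_iff_iteratedDeriv {f : ℂ → E} (hf : Differentiable ℂ f) (R S : E →L[ℂ] E')
    (c : ℂ) :
    (∀ z, R (f (c * z)) = S (f z)) ↔
      ∀ m, c ^ m • R (iteratedDeriv m f 0) = S (iteratedDeriv m f 0) := by
  constructor
  · intro h m
    have hderiv (T : E →L[ℂ] E') {g : ℂ → E} (hg : Differentiable ℂ g) :
        iteratedDeriv m (fun z => T (g z)) 0 = T (iteratedDeriv m g 0) := by
      simp only [iteratedDeriv_eq_iteratedFDeriv]
      exact congrArg (· fun _ => 1)
        (T.iteratedFDeriv_comp_left (hg.contDiff (n := m)).contDiffAt le_rfl)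
    have hscale : iteratedDeriv m (fun z => f (c * z)) 0 = c ^ m • iteratedDeriv m f 0 := by
      simpa using congrFun (iteratedDeriv_comp_const_smul (hf.contDiff (n := m)) c) 0
    rw [← map_smul, ← hscale, ← hderiv R (hf.fun_comp (by fun_prop : Differentiable ℂ (c * ·))),
      ← hderiv S hf, funext h]
  · intro h z
    have hR := (Complex.hasSum_taylorSeries_of_entire hf 0 (c * z)).mapL R
    have hS := (Complex.hasSum_taylorSeries_of_entire hf 0 z).mapL S
    refine hR.unique (hS.congr_fun fun m => ?_)
    simp only [sub_zero, map_smul, ← h m, mul_pow, smul_smul]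
    ring_nf

end Entire

section Matrices

open scoped Matrix.Norms.Elementwise

variable {n m : ℕ} {A : GL (Fin n) ℂ} {B : GL (Fin m) ℂ} {F : ℂ → Matrix (Fin m) (Fin n) ℂ} {q : ℂˣ}

lemma entire_intertwine (hF : Differentiable ℂ F)
    (h : ∀ z, F (q * z) * A.val = B.val * F z) (g : ZAlg) (z : ℂ) :
    F (g.1 q * z) * actMat g A = actMat g B * F z := by
  have htaylor (c : ℂ) (A' : Matrix (Fin n) (Fin n) ℂ) (B' : Matrix (Fin m) (Fin m) ℂ) :
      (∀ z, F (c * z) * A' = B' * F z) ↔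
        ∀ k, c ^ k • (iteratedDeriv k F 0 * A') = B' * iteratedDeriv k F 0 :=
    comp_const_mul_eq_iff_iteratedDeriv hF
      (LinearMap.toContinuousLinearMap (mulRightLinearMap (Fin m) ℂ A'))
      (LinearMap.toContinuousLinearMap (mulLeftLinearMap (Fin n) ℂ B')) c
  refine (htaylor _ _ _).2 (fun k => ?_) z
  have hk : iteratedDeriv k F 0 * (q ^ k • A).val = B.val * iteratedDeriv k F 0 := by
    rw [← (htaylor _ _ _).1 h k, ← Matrix.mul_smul]
    rfl
  rw [← actMat_intertwine g hk, actMat_smul, map_pow, Units.val_pow_eq_pow_val, Matrix.mul_smul]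

end Matrices

section Morphism

variable {q : ℂˣ} {X Y : FlatLocal q} (hq : 1 < ‖(q : ℂ)‖) (F : X ⟶ Y)

include hq in
lemma map_germEval_mul {z : ℂ} (hz : z ≠ 0) :
    (FlatSys.matrix F).map (germEval · (q * z)) * X.A.val =
      Y.A.val * (FlatSys.matrix F).map (germEval · z) := by
  obtain ⟨f, hf⟩ := exists_continues hq F
  have hσF (i j) : Continues ((FlatSys.matrix F).map (sigmaQ q) i j) fun z => f i j (q * z) :=
    (hf i j).sigmaQ q
  have hσ : (FlatSys.matrix F).map (germEval · (q * z)) =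
      ((FlatSys.matrix F).map (sigmaQ q)).map (germEval · z) := by
    ext i j
    exact ((hf i j).eval (mul_ne_zero q.ne_zero hz)).trans ((hσF i j).eval hz).symm
  have hcomm : (FlatSys.matrix F).map (sigmaQ q) * constMat MeroGerm X.A.val =
      constMat MeroGerm Y.A.val * FlatSys.matrix F := F.comm
  have hconst {n m : ℕ} (A : Matrix (Fin n) (Fin m) ℂ) (i j) :
      Continues (constMat MeroGerm A i j) fun _ => A i j := Continues.const _
  have h := congrArg (Matrix.map · (germEval · z)) hcomm
  beta_reduce at h
  rwa [germEval_mul hσF (hconst _) hz, germEval_mul (hconst _) hf hz,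
    germEval_constMat _ hz, germEval_constMat _ hz, ← hσ] at h

include hq in
lemma exists_differentiable_pow_smul_germEval :
    ∃ M ≠ 0, ∀ i j, Differentiable ℂ fun z => z ^ M * germEval (FlatSys.matrix F i j) z := by
  obtain ⟨f, hf⟩ := exists_continues hq F
  have hev : ∀ᶠ M in atTop, ∀ i j, Differentiable ℂ fun z => z ^ M * f i j z :=
    eventually_all.2 fun i => eventually_all.2 fun j => (hf i j).eventually_differentiable
  obtain ⟨M, hM, hM₀⟩ := (hev.and (eventually_ne_atTop 0)).exists
  refine ⟨M, hM₀, fun i j => ?_⟩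
  convert hM i j using 2 with z
  obtain rfl | hz := eq_or_ne z 0
  · rw [zero_pow hM₀, zero_mul, zero_mul]
  · rw [(hf i j).eval hz]

include hq in
lemma fibre_intertwine {z₀ z₁ : ℂˣ} {g : ZAlg} (hg : g.1 q * z₀ = z₁) :
    (FlatSys.matrix F).map (germEval · z₁) * actMat g X.A =
      actMat g Y.A * (FlatSys.matrix F).map (germEval · z₀) := by
  obtain ⟨M, hM₀, hM⟩ := exists_differentiable_pow_smul_germEval hq F
  set P : ℂ → Matrix (Fin Y.rank) (Fin X.rank) ℂ :=
    fun z => z ^ M • (FlatSys.matrix F).map (germEval · z) with hP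
  have hPdiff : Differentiable ℂ P := differentiable_pi.2 fun i => differentiable_pi.2 (hM i)
  have hPq (z : ℂ) : P (q * z) * X.A.val = (q ^ M • Y.A).val * P z := by
    obtain rfl | hz := eq_or_ne z 0
    · simp only [hP, mul_zero, zero_pow hM₀, zero_smul, Matrix.zero_mul, Matrix.mul_zero]
    · have h := map_germEval_mul hq F hz
      have hval : (q ^ M • Y.A).val = (q : ℂ) ^ M • Y.A.val := by
        simp [Units.smul_def]
      simp only [hP, Matrix.smul_mul, h, mul_pow, Matrix.mul_smul, mul_smul, hval]
      rw [smul_comm]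
  have h := entire_intertwine hPdiff hPq g z₀
  rw [← Units.val_mul, hg, actMat_smul] at h
  refine smul_right_injective _ (pow_ne_zero M z₁.ne_zero) ?_
  calc (z₁ : ℂ) ^ M • ((FlatSys.matrix F).map (germEval · z₁) * actMat g X.A)
      = ((g.1 (q ^ M) : ℂ) • actMat g Y.A) * P z₀ := by rw [← Matrix.smul_mul, h]
    _ = (z₁ : ℂ) ^ M • (actMat g Y.A * (FlatSys.matrix F).map (germEval · z₀)) := by
      rw [← hg, map_pow, Units.val_pow_eq_pow_val, Units.val_mul, mul_pow, mul_smul,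
        ← Matrix.mul_smul, Matrix.smul_mul]

end Morphism

section FibreIso

variable {q : ℂˣ} (hq : 1 < ‖(q : ℂ)‖) {z₀ z₁ : ℂˣ}

/-- The tensor isomorphism of fibre functors given by `(γ, t)` with `γ(q) z₀ = z₁`. -/
noncomputable def fibreIso (g : ZAlg) (hg : g.1 q * z₀ = z₁) : TensorIso q hq z₀ z₁ :=
  LaxMonoidalFunctor.isoOfComponents (fun X => actIso X.A g)
    (fun F => (fibre_intertwine hq F hg).symm) (actMat_unit g)
    (fun X Y => actMat_tensor X.A Y.A g)

lemma restrict_fibreIso (g : ZAlg) (hg : g.1 q * z₀ = z₁) :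
    restrict q hq z₀ z₁ (fibreIso hq g hg) = actAut g :=
  TensorAut.ext_mat fun _ _ => rfl

lemma restrict_injective (z₀ z₁ : ℂˣ) : Function.Injective (restrict q hq z₀ z₁) := by
  intro η θ h
  refine Iso.ext (LaxMonoidalFunctor.hom_ext (NatTrans.ext (funext fun X => ?_)))
  exact congrArg (fun α : TensorAut => α.hom.hom.app (⟨X.rank, X.A⟩ : RepZ)) h

end FibreIso

section Coordinate

/-- The germ of the coordinate `z`. -/
noncomputable def coordGerm : MeroGerm :=
  ⟨((fun z : ℂ => z : ℂ → ℂ) : Germ (𝓝[≠] (0 : ℂ)) ℂ), _, MeromorphicAt.id 0, rfl⟩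

lemma continues_coordGerm : Continues coordGerm fun z => z :=
  ⟨fun _ _ => analyticAt_id, rfl⟩

lemma sigmaQ_coordGerm (q : ℂˣ) :
    sigmaQ q coordGerm = algebraMap ℂ MeroGerm q * coordGerm := rfl

/-- Multiplication by `z`, as a morphism `(ℂ, 1) → (ℂ, q)`. -/
noncomputable def coordHom (q : ℂˣ) :
    (⟨1, 1⟩ : FlatLocal q) ⟶ ⟨1, q • (1 : GL (Fin 1) ℂ)⟩ :=
  FlatSys.Hom.mk (Matrix.of fun _ _ => coordGerm) (by
    refine Matrix.ext fun i j => ?_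
    obtain rfl : i = 0 := Subsingleton.elim (α := Fin 1) _ _
    obtain rfl : j = 0 := Subsingleton.elim (α := Fin 1) _ _
    simp [Matrix.mul_apply, constMat, Units.smul_def, sigmaQ_coordGerm])

lemma TensorIso.character_mul {q : ℂˣ} {hq : 1 < ‖(q : ℂ)‖} {z₀ z₁ : ℂˣ}
    (η : TensorIso q hq z₀ z₁) :
    TensorAut.character (restrict q hq z₀ z₁ η) q * z₀ = z₁ := by
  have h : TensorAut.mat (restrict q hq z₀ z₁ η) (q • (1 : GL (Fin 1) ℂ)) *
      (Matrix.of fun _ _ => coordGerm : Matrix (Fin 1) (Fin 1) MeroGerm).map (germEval · z₀) =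
      (Matrix.of fun _ _ => coordGerm : Matrix (Fin 1) (Fin 1) MeroGerm).map (germEval · z₁) *
        TensorAut.mat (restrict q hq z₀ z₁ η) 1 := η.hom.hom.naturality (coordHom q)
  rw [TensorAut.mat_one_right, TensorAut.mat_smul_one, Matrix.mul_one] at h
  refine Units.ext ?_
  simpa [continues_coordGerm.eval z₀.ne_zero, continues_coordGerm.eval z₁.ne_zero] using
    congrFun (congrFun h 0) 0

end Coordinate

end LocalFibres

end LocalGalois

/-- The tensor automorphisms of the forgetful functor on representations of `ℤ` are identified by
`e` with `ℤ^alg`, the pair `(γ, t)` acting on `(ℂ^n, A)` by `γ(A_s) A_u^t`; restriction to the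
representations of `ℤ` realizes `Iso^⊗(ω_{z₀}, ω_{z₁})` as the set of the pairs with
`γ(q) z₀ = z₁`. -/
theorem mainTheorem1 (q : ℂˣ) (hq : 1 < ‖(q : ℂ)‖) :
    ∃ e : LocalGalois.ZAlg ≃* LocalGalois.TensorAut,
      (∀ (g : LocalGalois.ZAlg) (X : LocalGalois.RepZ) (D : LocalGalois.Dunford X.A),
        (e g).hom.hom.app X = D.act g) ∧
      ∀ z₀ z₁ : ℂˣ,
        Function.Injective (LocalGalois.restrict q hq z₀ z₁) ∧
        Set.range (LocalGalois.restrict q hq z₀ z₁) =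
          e '' {g : LocalGalois.ZAlg | g.1 q * z₀ = z₁} := by
  refine ⟨LocalGalois.actEquiv, fun g X D => (D.act_eq_actMat g).symm, fun z₀ z₁ =>
    ⟨LocalGalois.restrict_injective hq z₀ z₁, Set.Subset.antisymm ?_ ?_⟩⟩
  · rintro _ ⟨η, rfl⟩
    obtain ⟨g, hg⟩ := LocalGalois.actEquiv.surjective (LocalGalois.restrict q hq z₀ z₁ η)
    have hγ : LocalGalois.TensorAut.character (LocalGalois.restrict q hq z₀ z₁ η) = g.1 := by
      rw [← hg]
      exact LocalGalois.character_actAut g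
    refine ⟨g, ?_, hg⟩
    rw [Set.mem_ofPred_eq, ← hγ, LocalGalois.TensorIso.character_mul]
  · rintro _ ⟨g, hg, rfl⟩
    exact ⟨LocalGalois.fibreIso hq g hg, LocalGalois.restrict_fibreIso hq g hg⟩
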